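/- Fix the following data. (a) A $C^\infty$ even function $\psi:\mathbb R\to[0,1]$ with closed support contained in $(-1,-\tfrac14)\cup(\tfrac14,1)$ and $\psi=1$ on $[-\tfrac34,-\tfrac12]\cup[\tfrac12,\tfrac34]$. For $t\ge 0$ put $\phi_t(x)=1-\sum_{n\in\mathbb Z}\psi(4^t(x+2n))$. (b) A $C^\infty$ even $2$-periodic function $q:\mathbb R\to(0,\infty)$, strictly increasing on $[-1,0]$ and strictly decreasing on $[0,1]$, so flat at $0$ that the functions $q_t(x)=\phi_t(x)\,(q(x)-q(4^{-t}))+q(4^{-t})$ converge to $q$ in the $C^\infty$ topology (all derivatives converge locally uniformly) as $t\to\infty$. (c) A $C^\infty$ even function $h:\mathbb R\to\mathbb R$ with closed support contained in $(-\tfrac34,-\tfrac12)\cup(\tfrac12,\tfrac34)$, and a point $x_\infty\in(\tfrac12,\tfrac34)$, such that for some strictly decreasing sequence $(x_i)_{i\ge1}$ in $(x_\infty,\tfrac34)$ with $x_i\to x_\infty$ and some constant $C>1$ one has, for every $i\ge1$, $(-1)^i h<0$ on $(x_{i+1},x_i)$ and $$\Bigl|\int_{x_{i+1}}^{x_i}h\,dx\Bigr|\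 \ge\ C\sum_{j=i+1}^\infty\Bigl|\int_{x_{j+1}}^{x_j}h\,dx\Bigr|.$$ For $t\ge0$ put $H_t(x)=\sum_{n\in\mathbb Z}h(4^t(x+2n))$. For a finite $1$-separated set $S\subset[0,\infty)$ (i.e. $|s-t|\ge1$ for distinct $s,t\in S$) and $\tau:S\to\mathbb R$ define $q_{S,\tau}:\mathbb R\to\mathbb R$ recursively by $q_{\varnothing,\tau}=q$ and, for any $t\in S$, with $S'=S\setminus\{t\}$ and $\tau'=\tau|_{S'}$, $$q_{S,\tau}(x)=\phi_t(x)\bigl(q_{S',\tau'}(x)-q_{S',\tau'}(4^{-t})\bigr)+q_{S',\tau'}(4^{-t})+\tau(t)H_t(x)$$ (the result does not depend on the choice of $t$). For an infinite $1$-separated set $S\subset[0,\infty)$ let $q_{S,\tau}$ be the pointwise limit of $q_{F,\tau|_F}$ along the finite subsets $F$ of $S$ directed by inclusion. For a smooth $Q:\mathbb R\to(0,\infty)$ and a positive integer $m$, let $\Lambda_{Q,m}$ be the first (least) eigenvalue $\lambda$ of the Dirichlet problem $u''+(\lambda Q-m^2)u=0$ on $[0,4]$, $u(0)=u(4)=0$.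 **Corollary.** For all such $\psi,q,h,x_\infty$ there exist positive integers $m_1,m_2,\dots$, an infinite set $S=\{t_1,t_2,\dots\}\subset[1,\infty)$ with $t_{i+1}\ge t_i+1$ for all $i$, and a function $\tau:S\to\mathbb R\setminus\{0\}$ such that the functions $q_{F,\tau|_F}$ converge to $Q:=q_{S,\tau}$ in the $C^\infty$ topology along the finite subsets $F\subset S$, the function $Q$ is positive and $C^\infty$-smooth, and $$\Lambda_{Q,m_i}\,Q(4^{-t_i}x_\infty)-m_i^2=0\qquad\text{for all } i\in\mathbb N .$$ -/

import Mathlib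

open Set Filter Topology
open scoped ContDiff

noncomputable section

namespace Cascade

/-- Convergence in the `C^∞` topology on functions of one real variable: every derivative
converges uniformly on compact sets (for periodic functions this is uniform convergence). -/
def TendstoSmooth {ι : Type*} (F : ι → ℝ → ℝ) (f : ℝ → ℝ) (l : Filter ι) : Prop :=
  ∀ n : ℕ, TendstoLocallyUniformly (fun i => iteratedDeriv n (F i)) (iteratedDeriv n f) l

/-- The rescaled `2`-periodization `x ↦ ∑_{n ∈ ℤ} f (4^t (x + 2 n))`.  For compactly supported `f`
only finitely many terms are nonzero at each `x`. -/
def periodize (f : ℝ → ℝ) (t : ℝ) (x : ℝ) : ℝ :=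
  ∑' n : ℤ, f ((4 : ℝ) ^ t * (x + 2 * (n : ℝ)))

/-- `φ_t = 1 - ∑ₙ ψ (4^t (x + 2 n))`. -/
def phi (ψ : ℝ → ℝ) (t : ℝ) (x : ℝ) : ℝ := 1 - periodize ψ t x

/-- `φ_t (x) (g (x) - g (4^{-t})) + g (4^{-t})`; for `g = q` this is the function `q_t`. -/
def pinch (ψ : ℝ → ℝ) (t : ℝ) (g : ℝ → ℝ) (x : ℝ) : ℝ :=
  phi ψ t x * (g x - g ((4 : ℝ) ^ (-t))) + g ((4 : ℝ) ^ (-t))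

/-- Smooth even cutoff `ψ : ℝ → [0,1]`. -/
structure IsCutoff (ψ : ℝ → ℝ) : Prop where
  smooth : ContDiff ℝ ∞ ψ
  even : ∀ x, ψ (-x) = ψ x
  mem_Icc : ∀ x, ψ x ∈ Icc (0 : ℝ) 1
  supp : tsupport ψ ⊆ Ioo (-1) (-1 / 4) ∪ Ioo (1 / 4) 1
  eq_one : ∀ x ∈ Icc (-3 / 4 : ℝ) (-1 / 2) ∪ Icc (1 / 2) (3 / 4), ψ x = 1

/-- The base function `q`, flat enough at `0` (relative to the cutoff `ψ`) that `q_t → q` in the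
`C^∞` topology as `t → ∞`. -/
structure IsBase (ψ q : ℝ → ℝ) : Prop where
  smooth : ContDiff ℝ ∞ q
  pos : ∀ x, 0 < q x
  even : ∀ x, q (-x) = q x
  periodic : ∀ x, q (x + 2) = q x
  increasing : StrictMonoOn q (Icc (-1) 0)
  decreasing : StrictAntiOn q (Icc 0 1)
  flat : TendstoSmooth (fun t : ℝ => pinch ψ t q) q atTop

/-- The oscillating function `h`, with rapidly decaying oscillations to the right of `a`.
The sequence of sign changes is indexed from `0`, so `x i` stands for `x_{i+1}`. -/
structure IsOscillating (h : ℝ → ℝ) (a : ℝ) : Prop where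
  smooth : ContDiff ℝ ∞ h
  even : ∀ x, h (-x) = h x
  supp : tsupport h ⊆ Ioo (-3 / 4) (-1 / 2) ∪ Ioo (1 / 2) (3 / 4)
  mem : a ∈ Ioo (1 / 2 : ℝ) (3 / 4)
  oscillates : ∃ x : ℕ → ℝ, StrictAnti x ∧ (∀ i, x i ∈ Ioo a (3 / 4)) ∧
    Tendsto x atTop (𝓝 a) ∧
    (∀ i, ∀ y ∈ Ioo (x (i + 1)) (x i), (-1) ^ (i + 1) * h y < 0) ∧
    ∃ C : ℝ, 1 < C ∧ ∀ i,
      C * ∑' j : ℕ, |∫ y in (x (i + j + 2))..(x (i + j + 1)), h y| ≤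
        |∫ y in (x (i + 1))..(x i), h y|

/-- One step of the construction: from `g` to
`φ_t (x) (g (x) - g (4^{-t})) + g (4^{-t}) + c H_t (x)`, where `H_t` is the rescaled
periodization of `h`. -/
def step (ψ h : ℝ → ℝ) (t c : ℝ) (g : ℝ → ℝ) (x : ℝ) : ℝ :=
  pinch ψ t g x + c * periodize h t x

/-- `q_{S,τ}` for a finite set `S`: one step for every `t ∈ S`, starting from `q`.  For
`1`-separated `S` the order of the steps is irrelevant; the element removed at each stage of the
recursion is here the smallest one.  Only the values of `τ` on `S` are used. -/
def qFin (ψ q h : ℝ → ℝ) (S : Finset ℝ) (τ : ℝ → ℝ) : ℝ → ℝ :=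
  (S.sort (· ≤ ·)).foldr (fun t g => step ψ h t (τ t) g) q

/-- `q_{F,τ}` for a finite subset `F` of `S`. -/
def qSub (ψ q h : ℝ → ℝ) (S : Set ℝ) (τ : ℝ → ℝ) (F : Finset S) : ℝ → ℝ :=
  qFin ψ q h (F.map (Function.Embedding.subtype _)) τ

/-- `q_{S,τ}` for an arbitrary set `S`: the pointwise limit of `q_{F,τ}` along the directed set of
finite subsets `F` of `S`. -/
def qSet (ψ q h : ℝ → ℝ) (S : Set ℝ) (τ : ℝ → ℝ) : ℝ → ℝ :=
  fun x => limUnder atTop (fun F : Finset S => qSub ψ q h S τ F x)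

/-- `lam` is an eigenvalue of the Dirichlet problem `u'' + (lam Q - m²) u = 0` on `[0,4]`,
`u 0 = u 4 = 0`. -/
def IsDirichletEigenvalue (Q : ℝ → ℝ) (m : ℕ) (lam : ℝ) : Prop :=
  ∃ u v : ℝ → ℝ,
    (∀ x ∈ Icc (0 : ℝ) 4, HasDerivWithinAt u (v x) (Icc 0 4) x) ∧
    (∀ x ∈ Icc (0 : ℝ) 4,
      HasDerivWithinAt v (-((lam * Q x - (m : ℝ) ^ 2) * u x)) (Icc 0 4) x) ∧
    u 0 = 0 ∧ u 4 = 0 ∧ ∃ x ∈ Icc (0 : ℝ) 4, u x ≠ 0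

/-- `lam = Λ_{Q,m}` is the first (least) eigenvalue of the Dirichlet problem. -/
def IsFirstDirichletEigenvalue (Q : ℝ → ℝ) (m : ℕ) (lam : ℝ) : Prop :=
  IsLeast {l : ℝ | IsDirichletEigenvalue Q m l} lam

end Cascade

end

/-! The scales `t i` are sought in intervals `[a i, b i]` that are more than distance one apart in
the sense `b i + 1 ≤ a (i + 1)`, with amplitudes `c i` fixed beforehand. The annuli where the
individual steps act are then disjoint, so the recursion collapses to a sum `Q = q + ∑ correction`.
The flatness of `q` and the smallness of `c i` bound the derivatives of order at most `i` of the
`i`-th term by `2 * (1/2)^i`, uniformly in `t i`; this gives smoothness, convergence in the smooth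
topology and continuity in the scales.

At `4^(-t i) * xInf` the cutoff is `1` and `h` vanishes, so `Q` equals `q (4^(-t i))` there. The
equations become `Λ * q (4^(-t i)) = (m i)^2`, where `Λ` still depends on all scales. If `t i = a
i`, then `Q` exceeds `q (4^(-a i))` by a definite factor on a fixed neighbourhood of its peak at
`2`, and Sturm comparison with a large `m i` makes the left side at most `(m i)^2`. If `t i = b i`,
then `Q ≤ q 0` together with `q (4^(-b i))` very close to `q 0` makes it at least `(m i)^2`. Both
signs hold whatever the other scales are, so the Poincaré–Miranda theorem on the Hilbert cube solves
all equations at once. The parameters at place `i` are chosen in the order `a`, `m`, `b`, `c`.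

The carrying results are `poincare_miranda`, proved by a mod 2 cup product on grids; the Prüfer
angle estimates `angle_lt_pi` and `pi_le_angle`, with `angle_firstEigenvalue` and
`tendsto_firstEigenvalue`; and `foldr_step_eq`, `limitFun_at_plateau`, `eigenvalue_upper` and
`eigenvalue_lower`. -/

noncomputable section

namespace Cascade

/-! ### A mod 2 cup product on the cubical grid and the Poincaré–Miranda theorem -/

section Grid

variable {ι : Type*} [DecidableEq ι]

/-- The mod 2 cup product of the coboundaries of the listed `0`-cochains, evaluated on the cube
with lowest vertex `p` and set of directions `I`. -/
def cup : List ((ι → ℕ) → ZMod 2) → Finset ι → (ι → ℕ) → ZMod 2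
  | [], _, _ => 1
  | w :: L, I, p =>
    ∑ j ∈ I, (w (p + Pi.single j 1) + w p) * cup L (I.erase j) (p + Pi.single j 1)

theorem sum_sum_erase_comm (I : Finset ι) (f : ι → ι → ZMod 2) :
    ∑ j ∈ I, ∑ k ∈ I.erase j, f j k = ∑ j ∈ I, ∑ k ∈ I.erase j, f k j := by
  refine Finset.sum_comm' fun j k => ?_
  simp only [Finset.mem_erase]
  constructor
  · rintro ⟨h1, h2, h3⟩; exact ⟨⟨h2.symm, h1⟩, h3⟩
  · rintro ⟨⟨h2, h1⟩, h3⟩; exact ⟨h1, h2.symm, h3⟩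

theorem sum_sum_erase_eq_zero (I : Finset ι) (f : ι → ι → ZMod 2) (hf : ∀ j k, f j k = f k j) :
    ∑ j ∈ I, ∑ k ∈ I.erase j, f j k = 0 := by
  rw [Finset.sum_sigma']
  refine Finset.sum_involution (fun x _ => ⟨x.2, x.1⟩) ?_ ?_ ?_ ?_
  · intro x _
    rw [hf x.2 x.1]
    exact CharTwo.add_self_eq_zero _
  · rintro ⟨j, k⟩ hx _ h
    simp only [Finset.mem_sigma, Finset.mem_erase] at hx
    simp only [Sigma.mk.injEq, heq_eq_eq] at h
    exact hx.2.1 h.1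
  · rintro ⟨j, k⟩ hx
    simp only [Finset.mem_sigma, Finset.mem_erase] at hx ⊢
    exact ⟨hx.2.2, hx.2.1.symm, hx.1⟩
  · rintro ⟨j, k⟩ _; rfl

/-- A product of coboundaries is a cocycle. By induction on the list: expanding the first factor
leaves double sums over ordered pairs of directions, which cancel mod 2 by symmetry or by closedness
of the shorter product. -/
theorem cup_closed (L : List ((ι → ℕ) → ZMod 2)) (I : Finset ι) (p : ι → ℕ) :
    ∑ j ∈ I, (cup L (I.erase j) (p + Pi.single j 1) + cup L (I.erase j) p) = 0 := by
  induction L generalizing I p with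
  | nil => exact Finset.sum_eq_zero fun j _ => CharTwo.add_self_eq_zero _
  | cons w L ih =>
    have key : ∀ j ∈ I, cup (w :: L) (I.erase j) (p + Pi.single j 1) + cup (w :: L) (I.erase j) p
        = ∑ k ∈ I.erase j, w (p + Pi.single j 1 + Pi.single k 1) *
            cup L ((I.erase j).erase k) (p + Pi.single j 1 + Pi.single k 1)
          + ∑ k ∈ I.erase j, w (p + Pi.single j 1) *
            cup L ((I.erase j).erase k) (p + Pi.single j 1 + Pi.single k 1)
          + ∑ k ∈ I.erase j, w (p + Pi.single k 1) *
            cup L ((I.erase j).erase k) (p + Pi.single k 1)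
          + ∑ k ∈ I.erase j, w p * cup L ((I.erase j).erase k) (p + Pi.single k 1) := by
      intro j _
      simp only [cup, ← Finset.sum_add_distrib]
      exact Finset.sum_congr rfl fun k _ => by ring
    rw [Finset.sum_congr rfl key]
    simp only [Finset.sum_add_distrib]
    have h1 : ∑ j ∈ I, ∑ k ∈ I.erase j, w (p + Pi.single j 1 + Pi.single k 1) *
        cup L ((I.erase j).erase k) (p + Pi.single j 1 + Pi.single k 1) = 0 := by
      refine sum_sum_erase_eq_zero I _ fun j k => ?_
      rw [add_right_comm, Finset.erase_right_comm]
    -- Closedness of the shorter product moves the base point one more step in the missing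
    -- direction, after which the summand is symmetric in `j` and `k`.
    have h4 : ∑ j ∈ I, ∑ k ∈ I.erase j, w p *
        cup L ((I.erase j).erase k) (p + Pi.single k 1) = 0 := by
      rw [sum_sum_erase_comm]
      have : ∀ j ∈ I, ∑ k ∈ I.erase j, w p * cup L ((I.erase k).erase j) (p + Pi.single j 1)
          = ∑ k ∈ I.erase j, w p *
            cup L ((I.erase j).erase k) (p + Pi.single j 1 + Pi.single k 1) := by
        intro j _
        rw [← Finset.mul_sum, ← Finset.mul_sum]
        congr 1
        have := ih (I.erase j) (p + Pi.single j 1)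
        rw [Finset.sum_add_distrib] at this
        rw [CharTwo.add_eq_zero.mp this]
        exact Finset.sum_congr rfl fun k _ => by rw [Finset.erase_right_comm]
      rw [Finset.sum_congr rfl this]
      refine sum_sum_erase_eq_zero I _ fun j k => ?_
      rw [add_right_comm, Finset.erase_right_comm]
    have h23 : ∑ j ∈ I, ∑ k ∈ I.erase j, w (p + Pi.single j 1) *
            cup L ((I.erase j).erase k) (p + Pi.single j 1 + Pi.single k 1)
          + ∑ j ∈ I, ∑ k ∈ I.erase j, w (p + Pi.single k 1) *
            cup L ((I.erase j).erase k) (p + Pi.single k 1) = 0 := by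
      refine (congrArg₂ (· + ·) rfl (sum_sum_erase_comm I _)).trans ?_
      rw [← Finset.sum_add_distrib]
      refine Finset.sum_eq_zero fun j _ => ?_
      have := ih (I.erase j) (p + Pi.single j 1)
      rw [← Finset.sum_add_distrib, ← mul_zero (w (p + Pi.single j 1)), ← this, Finset.mul_sum]
      exact Finset.sum_congr rfl fun k _ => by rw [Finset.erase_right_comm, mul_add]
    rw [h1, h4, zero_add, add_zero, h23]

/-- On a cube orthogonal to direction `j` inside a face `p j = 0` or `p j = k`, the label `w j` is
constant, so its coboundary kills the product. -/
theorem cup_eq_zero_of_face {k : ℕ} (w : ι → (ι → ℕ) → ZMod 2)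
    (h0 : ∀ i p, p i = 0 → w i p = 0) (h1 : ∀ i p, p i = k → w i p = 1)
    (l : List ι) (I : Finset ι) (p : ι → ℕ) (j : ι) (hj : j ∈ l) (hjI : j ∉ I)
    (hp : p j = 0 ∨ p j = k) : cup (l.map w) I p = 0 := by
  induction l generalizing I p with
  | nil => simp at hj
  | cons i l ih =>
    rw [List.map_cons, cup]
    refine Finset.sum_eq_zero fun d hd => ?_
    have hne : j ≠ d := fun h => hjI (h ▸ hd)
    have hval : (p + Pi.single d 1 : ι → ℕ) j = p j := by simp [hne]
    rcases List.mem_cons.mp hj with rfl | hj'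
    · rcases hp with hp | hp
      · rw [h0 _ _ hp, h0 _ _ (hval.trans hp), add_zero, zero_mul]
      · rw [h1 _ _ hp, h1 _ _ (hval.trans hp), CharTwo.add_self_eq_zero, zero_mul]
    · rw [ih _ _ hj' (fun h => hjI (Finset.mem_of_mem_erase h)) (by rwa [hval]), mul_zero]

theorem exists_change_of_cup_ne_zero (w : ι → (ι → ℕ) → ZMod 2) (l : List ι) (I : Finset ι)
    (p : ι → ℕ) (h : cup (l.map w) I p ≠ 0) (i : ι) (hi : i ∈ l) :
    ∃ u v : ι → ℕ, (∀ x, p x ≤ u x ∧ u x ≤ p x + if x ∈ I then 1 else 0) ∧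
      (∀ x, p x ≤ v x ∧ v x ≤ p x + if x ∈ I then 1 else 0) ∧ w i u ≠ w i v := by
  induction l generalizing I p with
  | nil => simp at hi
  | cons i' l ih =>
    rw [List.map_cons, cup] at h
    obtain ⟨d, hd, hne⟩ := Finset.exists_ne_zero_of_sum_ne_zero h
    rcases List.mem_cons.mp hi with rfl | hi'
    · refine ⟨p + Pi.single d 1, p, fun x => ?_, fun x => by simp, fun he => ?_⟩
      · by_cases hx : x = d
        · subst hx; simp [hd]
        · simp [hx]
      · rw [he, CharTwo.add_self_eq_zero, zero_mul] at hne
        exact hne rfl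
    · obtain ⟨u, v, hu, hv, hw⟩ := ih _ _ (right_ne_zero_of_mul hne) hi'
      have aux : ∀ y : ι → ℕ, (∀ x, (p + Pi.single d 1 : ι → ℕ) x ≤ y x ∧ y x ≤
          (p + Pi.single d 1 : ι → ℕ) x +
          if x ∈ I.erase d then 1 else 0) → ∀ x, p x ≤ y x ∧ y x ≤ p x + if x ∈ I then 1 else 0 := by
        intro y hy x
        have := hy x
        by_cases hx : x = d
        · subst hx; simp [hd] at this ⊢; omega
        · simpa [Pi.single_apply, hx] using this
      exact ⟨u, v, aux u hu, aux v hv, hw⟩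

variable [Fintype ι]

/-- Discrete Stokes in one direction: interior layers are counted twice and cancel mod 2, leaving
the two end faces. -/
theorem sum_piFinset_telescope {k : ℕ} (s : ι → Finset ℕ) (j : ι) (hs : s j = Finset.range k)
    (G : (ι → ℕ) → ZMod 2) :
    ∑ p ∈ Fintype.piFinset s, (G (p + Pi.single j 1) + G p) =
      ∑ p ∈ Fintype.piFinset (Function.update s j {k}), G p +
      ∑ p ∈ Fintype.piFinset (Function.update s j {0}), G p := by
  have split : ∀ A B : Finset ℕ, Disjoint A B →
      ∑ p ∈ Fintype.piFinset (Function.update s j (A ∪ B)), G p =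
      ∑ p ∈ Fintype.piFinset (Function.update s j A), G p +
      ∑ p ∈ Fintype.piFinset (Function.update s j B), G p := by
    intro A B hAB
    rw [← Finset.sum_union]
    · congr 1
      ext p
      simp only [Fintype.mem_piFinset, Finset.mem_union]
      constructor
      · intro h
        have hj := h j
        simp only [Function.update_self, Finset.mem_union] at hj
        rcases hj with hj | hj
        · left; intro x
          by_cases hx : x = j
          · subst hx; simpa using hj
          · simpa [hx] using h x
        · right; intro x
          by_cases hx : x = j
          · subst hx; simpa using hj
          · simpa [hx] using h x
      · rintro (h | h) x
        · by_cases hx : x = j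
          · subst hx; have := h x; simp at this ⊢; exact Or.inl this
          · simpa [hx] using h x
        · by_cases hx : x = j
          · subst hx; have := h x; simp at this ⊢; exact Or.inr this
          · simpa [hx] using h x
    · rw [Finset.disjoint_left]
      intro p h1 h2
      have h1 := Fintype.mem_piFinset.mp h1 j
      have h2 := Fintype.mem_piFinset.mp h2 j
      simp only [Function.update_self] at h1 h2
      exact Finset.disjoint_left.mp hAB h1 h2
  have shift : ∑ p ∈ Fintype.piFinset s, G (p + Pi.single j 1) =
      ∑ p ∈ Fintype.piFinset (Function.update s j (Finset.Ico 1 (k + 1))), G p := by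
    refine Finset.sum_bij' (fun p _ => p + Pi.single j 1) (fun p _ => p - Pi.single j 1) ?_ ?_ ?_ ?_ ?_
    · intro p hp
      rw [Fintype.mem_piFinset] at hp ⊢
      intro x
      by_cases hx : x = j
      · subst hx; have := hp x; rw [hs] at this; simp at this ⊢; omega
      · simpa [Pi.single_apply, hx] using hp x
    · intro p hp
      rw [Fintype.mem_piFinset] at hp ⊢
      intro x
      by_cases hx : x = j
      · subst hx; have := hp x; rw [hs]; simp at this ⊢; omega
      · simpa [Pi.single_apply, hx] using hp x
    · intro p _; simp
    · intro p hp
      rw [Fintype.mem_piFinset] at hp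
      funext x
      by_cases hx : x = j
      · subst hx; have := hp x; simp at this ⊢; omega
      · simp [hx]
    · intro p _; rfl
  have e0 : Function.update s j (Finset.range k) = s := by rw [← hs, Function.update_eq_self]
  have hA := split {0} (Finset.Ico 1 (k + 1)) (by simp)
  have hB := split (Finset.range k) {k} (by simp)
  have hAB : ({0} : Finset ℕ) ∪ Finset.Ico 1 (k + 1) = Finset.range k ∪ {k} := by
    ext x; simp; omega
  rw [hAB, hB, e0] at hA
  rw [Finset.sum_add_distrib, shift]
  generalize ∑ p ∈ Fintype.piFinset s, G p = a at *
  generalize ∑ p ∈ Fintype.piFinset (Function.update s j {k}), G p = b at *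
  generalize ∑ p ∈ Fintype.piFinset (Function.update s j {0}), G p = c at *
  generalize ∑ p ∈ Fintype.piFinset (Function.update s j (Finset.Ico 1 (k + 1))), G p = d at *
  clear * - hA
  revert a b c d
  decide

/-- Evaluates the product on the fundamental class. Since the remaining product is closed, the first
coboundary can be pulled out, and Stokes leaves boundary faces only. All of them vanish except `p i
= k`, where `w i = 1`; the induction continues on that face. Coordinates outside `l` are frozen at
`k` for this purpose. -/
theorem sum_cup_eq_one {k : ℕ} (w : ι → (ι → ℕ) → ZMod 2)
    (h0 : ∀ i p, p i = 0 → w i p = 0) (h1 : ∀ i p, p i = k → w i p = 1)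
    (l : List ι) (hl : l.Nodup) :
    ∑ p ∈ Fintype.piFinset (fun i => if i ∈ l then Finset.range k else {k}),
      cup (l.map w) l.toFinset p = 1 := by
  induction l with
  | nil => simp [cup]
  | cons i l ih =>
    obtain ⟨hil, hl'⟩ := List.nodup_cons.mp hl
    set s : ι → Finset ℕ := fun x => if x ∈ i :: l then Finset.range k else {k} with hs
    set I := (i :: l).toFinset with hI
    have hexp : ∀ p, cup ((i :: l).map w) I p = ∑ j ∈ I,
        (w i (p + Pi.single j 1) * cup (l.map w) (I.erase j) (p + Pi.single j 1) +
          w i p * cup (l.map w) (I.erase j) p) := by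
      intro p
      -- Adding `w i p` times the cocycle identity is the Leibniz rule in disguise: it turns the
      -- product into a full coboundary.
      rw [List.map_cons, cup, ← add_zero (∑ j ∈ I, (_ + _ : ZMod 2)),
        ← mul_zero (w i p), ← cup_closed (l.map w) I p, Finset.mul_sum, ← Finset.sum_add_distrib]
      refine Finset.sum_congr rfl fun j _ => ?_
      generalize w i (p + Pi.single j 1) = a
      generalize w i p = b
      generalize cup (l.map w) (I.erase j) (p + Pi.single j 1) = c
      generalize cup (l.map w) (I.erase j) p = d
      revert a b c d
      decide
    rw [Finset.sum_congr rfl fun p _ => hexp p, Finset.sum_comm]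
    have hsj : ∀ j ∈ I, s j = Finset.range k := by
      intro j hj
      simp only [hs]
      rw [if_pos (List.mem_toFinset.mp hj)]
    rw [Finset.sum_congr rfl fun j hj => sum_piFinset_telescope s j (hsj j hj)
      fun p => w i p * cup (l.map w) (I.erase j) p]
    have hpj : ∀ (j : ι) (a : ℕ) (p : ι → ℕ), p ∈ Fintype.piFinset (Function.update s j {a}) →
        p j = a := by
      intro j a p hp
      simpa using Fintype.mem_piFinset.mp hp j
    rw [Finset.sum_eq_single i]
    · rw [Finset.sum_eq_zero (s := Fintype.piFinset (Function.update s i {0})), add_zero, ← ih hl']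
      · have : Function.update s i {k} = fun x => if x ∈ l then Finset.range k else {k} := by
          funext x
          by_cases hx : x = i
          · subst hx; simp [hil]
          · simp [hs, hx]
        rw [this]
        refine Finset.sum_congr rfl fun p hp => ?_
        rw [← this] at hp
        rw [h1 _ _ (hpj _ _ _ hp), one_mul]
        congr 1
        rw [hI, List.toFinset_cons, Finset.erase_insert (by simpa using hil)]
      · intro p hp
        rw [h0 _ _ (hpj _ _ _ hp), zero_mul]
    · intro j hj hji
      have hjl : j ∈ l := by
        rcases List.mem_cons.mp (List.mem_toFinset.mp hj) with h | h
        · exact absurd h hji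
        · exact h
      rw [Finset.sum_eq_zero, Finset.sum_eq_zero, add_zero]
      · intro p hp
        rw [cup_eq_zero_of_face w h0 h1 l _ p j hjl (Finset.notMem_erase _ _)
          (Or.inl (hpj _ _ _ hp)), mul_zero]
      · intro p hp
        rw [cup_eq_zero_of_face w h0 h1 l _ p j hjl (Finset.notMem_erase _ _)
          (Or.inr (hpj _ _ _ hp)), mul_zero]
    · intro h
      exact absurd (by simp [hI]) h

/-- Discrete Poincaré–Miranda theorem: some small cube of the grid sees a change of every label. -/
theorem exists_cube_all_labels {k : ℕ} (w : ι → (ι → ℕ) → ZMod 2)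
    (h0 : ∀ i p, p i = 0 → w i p = 0) (h1 : ∀ i p, p i = k → w i p = 1) :
    ∃ p : ι → ℕ, (∀ x, p x < k) ∧ ∀ i, ∃ u v : ι → ℕ, (∀ x, p x ≤ u x ∧ u x ≤ p x + 1) ∧
      (∀ x, p x ≤ v x ∧ v x ≤ p x + 1) ∧ w i u = 1 ∧ w i v = 0 := by
  have hT := sum_cup_eq_one w h0 h1 Finset.univ.toList (Finset.nodup_toList _)
  obtain ⟨p, hp, hne⟩ := Finset.exists_ne_zero_of_sum_ne_zero (hT ▸ one_ne_zero)
  refine ⟨p, fun x => ?_, fun i => ?_⟩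
  · simpa using Fintype.mem_piFinset.mp hp x
  · obtain ⟨u, v, hu, hv, hw⟩ := exists_change_of_cup_ne_zero w _ _ p hne i (by simp)
    simp only [Finset.toList_toFinset, Finset.mem_univ, if_true] at hu hv
    have : ∀ a b : ZMod 2, a ≠ b → a = 1 ∧ b = 0 ∨ b = 1 ∧ a = 0 := by decide
    rcases this _ _ hw with h | h
    · exact ⟨u, v, hu, hv, h⟩
    · exact ⟨v, u, hv, hu, h⟩

end Grid

/-- Approximate form of the Poincaré–Miranda theorem for the first `N` coordinates. -/
theorem exists_approx_zero (F : ℕ → (ℕ → ℝ) → ℝ)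
    (h0 : ∀ i, ∀ s ∈ univ.pi fun _ : ℕ => Icc (0 : ℝ) 1, s i = 0 → F i s ≤ 0)
    (h1 : ∀ i, ∀ s ∈ univ.pi fun _ : ℕ => Icc (0 : ℝ) 1, s i = 1 → 0 ≤ F i s)
    (N : ℕ) (hN : 0 < N) :
    ∃ y ∈ univ.pi fun _ : ℕ => Icc (0 : ℝ) 1, ∃ u v : ℕ → ℕ → ℝ, ∀ i < N,
      (u i ∈ univ.pi fun _ : ℕ => Icc (0 : ℝ) 1) ∧ (v i ∈ univ.pi fun _ : ℕ => Icc (0 : ℝ) 1) ∧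
      (∀ x, |u i x - y x| ≤ 1 / N) ∧ (∀ x, |v i x - y x| ≤ 1 / N) ∧
      0 ≤ F i (u i) ∧ F i (v i) ≤ 0 := by
  classical
  have hN' : (0 : ℝ) < N := by exact_mod_cast hN
  set emb : (Fin N → ℕ) → ℕ → ℝ := fun p x => if h : x < N then (p ⟨x, h⟩ : ℝ) / N else 0 with hemb
  have emb_mem : ∀ p : Fin N → ℕ, (∀ x, p x ≤ N) →
      emb p ∈ univ.pi fun _ : ℕ => Icc (0 : ℝ) 1 := by
    intro p hp x _
    simp only [hemb]
    split_ifs with h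
    · refine ⟨by positivity, (div_le_one hN').mpr ?_⟩
      exact_mod_cast hp _
    · simp
  have emb_dist : ∀ p u : Fin N → ℕ, (∀ x, p x ≤ u x ∧ u x ≤ p x + 1) → ∀ x,
      |emb u x - emb p x| ≤ 1 / N := by
    intro p u hu x
    simp only [hemb]
    split_ifs with h
    · have ha : (p ⟨x, h⟩ : ℝ) ≤ u ⟨x, h⟩ := by exact_mod_cast (hu _).1
      have hb : (u ⟨x, h⟩ : ℝ) ≤ p ⟨x, h⟩ + 1 := by exact_mod_cast (hu _).2
      rw [← sub_div, abs_div, abs_of_pos hN', abs_of_nonneg (by linarith)]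
      gcongr
      linarith
    · simp
  -- Labels record the sign of `F i`, but are forced on the two faces, because the hypotheses there
  -- are only weak inequalities and would not determine the label.
  set w : Fin N → (Fin N → ℕ) → ZMod 2 := fun i p =>
    if p i = N ∨ (p i ≠ 0 ∧ 0 < F i (emb p)) then 1 else 0 with hw
  obtain ⟨p, hp, hlab⟩ := exists_cube_all_labels (k := N) w
    (fun i p hi => by simp [hw, hi]; omega) (fun i p hi => by simp [hw, hi])
  choose u v hu hv hwu hwv using hlab
  have hle : ∀ y : Fin N → ℕ, (∀ x, p x ≤ y x ∧ y x ≤ p x + 1) → ∀ x, y x ≤ N := by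
    intro y hy x
    have := hp x
    have := (hy x).2
    omega
  refine ⟨emb p, emb_mem p fun x => (hp x).le,
    fun i => if h : i < N then emb (u ⟨i, h⟩) else 0,
    fun i => if h : i < N then emb (v ⟨i, h⟩) else 0, fun i hi => ?_⟩
  simp only [hi, dite_true]
  have mu := emb_mem _ (hle _ (hu ⟨i, hi⟩))
  have mv := emb_mem _ (hle _ (hv ⟨i, hi⟩))
  refine ⟨mu, mv, emb_dist _ _ (hu _), emb_dist _ _ (hv _), ?_, ?_⟩
  · have := hwu ⟨i, hi⟩
    simp only [hw] at this
    split_ifs at this with h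
    · rcases h with h | h
      · refine h1 i _ mu ?_
        simp only [hemb, hi, dite_true, h]
        exact div_self hN'.ne'
      · exact h.2.le
    · exact absurd this (by decide)
  · have := hwv ⟨i, hi⟩
    simp only [hw] at this
    split_ifs at this with h
    · exact absurd this (by decide)
    · push Not at h
      by_cases h' : v ⟨i, hi⟩ ⟨i, hi⟩ = 0
      · refine h0 i _ mv ?_
        simp only [hemb, hi, dite_true, h']
        simp
      · exact h.2 h'

/-- Poincaré–Miranda theorem on the Hilbert cube. -/
theorem poincare_miranda (F : ℕ → (ℕ → ℝ) → ℝ)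
    (hF : ∀ i, ContinuousOn (F i) (univ.pi fun _ : ℕ => Icc (0 : ℝ) 1))
    (h0 : ∀ i, ∀ s ∈ univ.pi fun _ : ℕ => Icc (0 : ℝ) 1, s i = 0 → F i s ≤ 0)
    (h1 : ∀ i, ∀ s ∈ univ.pi fun _ : ℕ => Icc (0 : ℝ) 1, s i = 1 → 0 ≤ F i s) :
    ∃ s ∈ univ.pi fun _ : ℕ => Icc (0 : ℝ) 1, ∀ i, F i s = 0 := by
  choose y hy u v huv using fun n : ℕ => exists_approx_zero F h0 h1 (n + 1) n.succ_pos
  have hK : IsCompact (univ.pi fun _ : ℕ => Icc (0 : ℝ) 1) := isCompact_univ_pi fun _ => isCompact_Icc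
  obtain ⟨s, hs, φ, hφ, hlim⟩ := hK.tendsto_subseq hy
  refine ⟨s, hs, fun i => ?_⟩
  have hev : ∀ᶠ n in atTop, i < φ n + 1 := by
    filter_upwards [eventually_ge_atTop i] with n hn
    have := hφ.id_le n
    simp only [id] at this
    omega
  have hsmall : Tendsto (fun n => 1 / ((φ n + 1 : ℕ) : ℝ)) atTop (𝓝 0) := by
    have := (tendsto_one_div_add_atTop_nhds_zero_nat (𝕜 := ℝ)).comp hφ.tendsto_atTop
    refine this.congr fun n => by simp
  -- Convergence in the product is coordinatewise, and the sample points are within the mesh of `y`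
  -- once the grid has more than `i` coordinates; both samples thus tend to `s`.
  have conv : ∀ z : ℕ → ℕ → ℕ → ℝ, (∀ n, ∀ i < n + 1, z n i ∈ univ.pi fun _ : ℕ => Icc (0 : ℝ) 1) →
      (∀ n, ∀ i < n + 1, ∀ x, |z n i x - y n x| ≤ 1 / ((n + 1 : ℕ) : ℝ)) →
      Tendsto (fun n => F i (z (φ n) i)) atTop (𝓝 (F i s)) := by
    intro z hz1 hz2
    refine (hF i s hs).tendsto.comp (tendsto_nhdsWithin_iff.mpr ⟨?_, ?_⟩)
    · rw [tendsto_pi_nhds] at hlim ⊢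
      intro x
      have hd : Tendsto (fun n => z (φ n) i x - y (φ n) x) atTop (𝓝 0) := by
        refine squeeze_zero_norm' ?_ hsmall
        filter_upwards [hev] with n hn
        exact hz2 _ _ hn x
      simpa using hd.add (hlim x)
    · filter_upwards [hev] with n hn
      exact hz1 _ _ hn
  refine le_antisymm ?_ ?_
  · refine le_of_tendsto (conv v (fun n i hi => (huv n i hi).2.1)
      fun n i hi => (huv n i hi).2.2.2.1) ?_
    filter_upwards [hev] with n hn
    exact (huv _ _ hn).2.2.2.2.2
  · refine ge_of_tendsto (conv u (fun n i hi => (huv n i hi).1)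
      fun n i hi => (huv n i hi).2.2.1) ?_
    filter_upwards [hev] with n hn
    exact (huv _ _ hn).2.2.2.2.1

/-! ### The Prüfer angle and the first Dirichlet eigenvalue -/

/-- Comparison of a subsolution and a supersolution of a scalar differential equation whose right
hand side satisfies a one-sided Lipschitz condition. -/
theorem le_of_subsolution_of_supersolution {f f' g g' : ℝ → ℝ} {F : ℝ → ℝ → ℝ} {K a b : ℝ}
    (hf : ContinuousOn f (Icc a b)) (hf' : ∀ x ∈ Ico a b, HasDerivWithinAt f (f' x) (Ici x) x)
    (hg : ContinuousOn g (Icc a b)) (hg' : ∀ x ∈ Ico a b, HasDerivWithinAt g (g' x) (Ici x) x)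
    (hF : ∀ x ∈ Ico a b, ∀ y z, z ≤ y → F x y - F x z ≤ K * (y - z))
    (hfF : ∀ x ∈ Ico a b, f' x ≤ F x (f x)) (hgF : ∀ x ∈ Ico a b, F x (g x) ≤ g' x)
    (ha : f a ≤ g a) : ∀ x ∈ Icc a b, f x ≤ g x := by
  intro x hx
  -- Adding `ε * exp ((K + 1) * x)` makes the supersolution strict, because its growth rate `K + 1`
  -- beats the Lipschitz constant `K`.
  have key : ∀ ε > 0, f x ≤ g x + ε * Real.exp ((K + 1) * x) := by
    intro ε hε
    have hexp : ∀ y, HasDerivAt (fun y => ε * Real.exp ((K + 1) * y))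
        (ε * (Real.exp ((K + 1) * y) * (K + 1))) y := by
      intro y
      have := ((hasDerivAt_id y).const_mul (K + 1)).exp.const_mul ε
      simpa using this
    refine image_le_of_deriv_right_lt_deriv_boundary' hf hf'
      (B := fun y => g y + ε * Real.exp ((K + 1) * y))
      (B' := fun y => g' y + ε * (Real.exp ((K + 1) * y) * (K + 1)))
      (by have := Real.exp_pos ((K + 1) * a); nlinarith)
      (hg.add (by fun_prop)) (fun y hy => (hg' y hy).add (hexp y).hasDerivWithinAt) ?_ hx
    intro y hy hfy
    have hpos : 0 < ε * Real.exp ((K + 1) * y) := by positivity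
    have h1 := hF y hy (f y) (g y) (by linarith)
    have h2 := hfF y hy
    have h3 := hgF y hy
    have h4 : f y - g y = ε * Real.exp ((K + 1) * y) := by linarith
    rw [h4] at h1
    nlinarith
  have hlim : Tendsto (fun ε : ℝ => g x + ε * Real.exp ((K + 1) * x)) (𝓝[>] 0) (𝓝 (g x)) := by
    have : Continuous fun ε : ℝ => g x + ε * Real.exp ((K + 1) * x) := by fun_prop
    simpa using (this.tendsto 0).mono_left nhdsWithin_le_nhds
  exact ge_of_tendsto hlim (by filter_upwards [self_mem_nhdsWithin] with ε hε using key ε hε)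

/-- The right hand side `cos² θ + V sin² θ` of the Prüfer equation. -/
def pruferField (V : ℝ → ℝ) (x θ : ℝ) : ℝ := 1 + (V x - 1) * Real.sin θ ^ 2

/-- `θ` is the Prüfer angle on `[0,4]` of the solution of `u'' + V u = 0` with `u 0 = 0`. -/
def IsPrufer (V θ : ℝ → ℝ) : Prop :=
  θ 0 = 0 ∧ ∀ x ∈ Icc (0 : ℝ) 4, HasDerivWithinAt θ (pruferField V x (θ x)) (Icc 0 4) x

/-- A choice of the Prüfer angle. -/
def angle (V : ℝ → ℝ) : ℝ → ℝ := Classical.epsilon (IsPrufer V)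

theorem abs_pruferField_sub_le {V : ℝ → ℝ} {B x : ℝ} (hB : |V x| ≤ B) (y z : ℝ) :
    |pruferField V x y - pruferField V x z| ≤ 2 * (B + 1) * |y - z| := by
  have h1 : pruferField V x y - pruferField V x z =
      (V x - 1) * ((Real.sin y + Real.sin z) * (Real.sin y - Real.sin z)) := by
    unfold pruferField; ring
  have h2 : |V x - 1| ≤ B + 1 := (abs_sub _ _).trans (by simpa using hB)
  have h3 : |Real.sin y + Real.sin z| ≤ 2 := (abs_add_le _ _).trans
    (by linarith [Real.abs_sin_le_one y, Real.abs_sin_le_one z])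
  have h4 := Real.abs_sin_sub_sin_le y z
  rw [h1, abs_mul, abs_mul]
  calc |V x - 1| * (|Real.sin y + Real.sin z| * |Real.sin y - Real.sin z|)
      ≤ (B + 1) * (2 * |y - z|) := by
        have : 0 ≤ B + 1 := (abs_nonneg _).trans h2
        gcongr
    _ = _ := by ring

theorem exists_abs_le_of_continuous {V : ℝ → ℝ} (hV : Continuous V) :
    ∃ B, 0 ≤ B ∧ ∀ x ∈ Icc (0 : ℝ) 4, |V x| ≤ B := by
  obtain ⟨B, hB⟩ := isCompact_Icc.exists_bound_of_continuousOn (s := Icc (0 : ℝ) 4) hV.continuousOn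
  exact ⟨B, (norm_nonneg _).trans (hB 0 (by norm_num)), hB⟩

theorem angle_spec {V : ℝ → ℝ} (hV : Continuous V) : IsPrufer V (angle V) := by
  refine Classical.epsilon_spec (p := IsPrufer V) ?_
  obtain ⟨B, hB0, hB⟩ := exists_abs_le_of_continuous hV
  -- The field is bounded by `B + 2`, so over length `4` no solution leaves the ball of radius `4 *
  -- (B + 2)`: local existence already covers the whole interval.
  have hPL : IsPicardLindelof (pruferField V) (⟨0, by norm_num⟩ : Icc (0 : ℝ) 4) 0
      (4 * (B + 2)).toNNReal 0 (B + 2).toNNReal (2 * (B + 1)).toNNReal := by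
    refine ⟨fun t ht => LipschitzWith.lipschitzOnWith ?_, fun y _ => ?_, fun t ht y _ => ?_, ?_⟩
    · refine LipschitzWith.of_dist_le_mul fun y z => ?_
      rw [Real.coe_toNNReal _ (by positivity), Real.dist_eq, Real.dist_eq]
      exact abs_pruferField_sub_le (hB t ht) y z
    · unfold pruferField; fun_prop
    · rw [Real.coe_toNNReal _ (by positivity), Real.norm_eq_abs, pruferField]
      have h1 : |V t - 1| ≤ B + 1 := (abs_sub _ _).trans (by simpa using hB t ht)
      have h2 : |Real.sin y ^ 2| ≤ 1 := by
        rw [abs_of_nonneg (sq_nonneg _)]; exact Real.sin_sq_le_one y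
      calc |1 + (V t - 1) * Real.sin y ^ 2| ≤ |1| + |(V t - 1) * Real.sin y ^ 2| := abs_add_le _ _
        _ ≤ 1 + (B + 1) * 1 := by rw [abs_mul, abs_one]; gcongr
        _ = B + 2 := by ring
    · rw [Real.coe_toNNReal _ (by positivity), Real.coe_toNNReal _ (by positivity)]
      norm_num
      linarith
  obtain ⟨θ, h0, h1⟩ := hPL.exists_eq_forall_mem_Icc_hasDerivWithinAt₀
  exact ⟨θ, h0, h1⟩

theorem HasDerivWithinAt.Ici_of_Icc {f : ℝ → ℝ} {f' a b x : ℝ}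
    (h : HasDerivWithinAt f f' (Icc a b) x) (hx : x ∈ Ico a b) :
    HasDerivWithinAt f f' (Ici x) x :=
  h.mono_of_mem_nhdsWithin (Icc_mem_nhdsGE_of_mem hx)

theorem angle_continuousOn {V : ℝ → ℝ} (hV : Continuous V) : ContinuousOn (angle V) (Icc 0 4) :=
  fun x hx => ((angle_spec hV).2 x hx).continuousWithinAt

theorem angle_deriv {V : ℝ → ℝ} (hV : Continuous V) {x : ℝ} (hx : x ∈ Ico (0 : ℝ) 4) :
    HasDerivWithinAt (angle V) (pruferField V x (angle V x)) (Ici x) x :=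
  HasDerivWithinAt.Ici_of_Icc ((angle_spec hV).2 x ⟨hx.1, hx.2.le⟩) hx

/-- A supersolution of the Prüfer equation lies above the Prüfer angle. -/
theorem angle_le {V g g' : ℝ → ℝ} (hV : Continuous V) (hg : ContinuousOn g (Icc 0 4))
    (hg' : ∀ x ∈ Ico (0 : ℝ) 4, HasDerivWithinAt g (g' x) (Ici x) x)
    (hgF : ∀ x ∈ Ico (0 : ℝ) 4, pruferField V x (g x) ≤ g' x) (h0 : 0 ≤ g 0) :
    ∀ x ∈ Icc (0 : ℝ) 4, angle V x ≤ g x := by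
  obtain ⟨B, hB0, hB⟩ := exists_abs_le_of_continuous hV
  refine le_of_subsolution_of_supersolution (F := pruferField V) (K := 2 * (B + 1))
    (angle_continuousOn hV) (fun x hx => angle_deriv hV hx) hg hg' (fun x hx y z hyz => ?_)
    (fun x _ => le_rfl) hgF (by rw [(angle_spec hV).1]; exact h0)
  have := abs_pruferField_sub_le (hB x ⟨hx.1, hx.2.le⟩) y z
  rw [abs_of_nonneg (sub_nonneg.mpr hyz)] at this
  exact (le_abs_self _).trans this

/-- A subsolution of the Prüfer equation on `[a,4]` lies below the Prüfer angle. -/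
theorem le_angle {V g g' : ℝ → ℝ} (hV : Continuous V) {a : ℝ} (ha : 0 ≤ a)
    (hg : ContinuousOn g (Icc a 4))
    (hg' : ∀ x ∈ Ico a 4, HasDerivWithinAt g (g' x) (Ici x) x)
    (hgF : ∀ x ∈ Ico a 4, g' x ≤ pruferField V x (g x)) (h0 : g a ≤ angle V a) :
    ∀ x ∈ Icc a 4, g x ≤ angle V x := by
  obtain ⟨B, hB0, hB⟩ := exists_abs_le_of_continuous hV
  refine le_of_subsolution_of_supersolution (F := pruferField V) (K := 2 * (B + 1)) hg hg'
    ((angle_continuousOn hV).mono (Icc_subset_Icc_left ha))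
    (fun x hx => angle_deriv hV ⟨ha.trans hx.1, hx.2⟩) (fun x hx y z hyz => ?_) hgF
    (fun x _ => le_rfl) h0
  have := abs_pruferField_sub_le (hB x ⟨ha.trans hx.1, hx.2.le⟩) y z
  rw [abs_of_nonneg (sub_nonneg.mpr hyz)] at this
  exact (le_abs_self _).trans this

theorem angle_mono {V W : ℝ → ℝ} (hV : Continuous V) (hW : Continuous W)
    (h : ∀ x ∈ Icc (0 : ℝ) 4, V x ≤ W x) : angle V 4 ≤ angle W 4 := by
  refine angle_le hV (angle_continuousOn hW) (fun x hx => angle_deriv hW hx) (fun x hx => ?_)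
    (angle_spec hW).1.ge 4 (by norm_num)
  unfold pruferField
  have := h x ⟨hx.1, hx.2.le⟩
  gcongr

/-- The Prüfer angle of `W`, raised by an exponential faster than the Lipschitz constant of the
field of `V`, is a supersolution for `V`. This gives continuity in the potential. -/
theorem angle_le_add {V W : ℝ → ℝ} (hV : Continuous V) (hW : Continuous W) {B ε : ℝ}
    (hB : ∀ x ∈ Icc (0 : ℝ) 4, |V x| ≤ B) (hε : 0 ≤ ε)
    (h : ∀ x ∈ Icc (0 : ℝ) 4, V x ≤ W x + ε) :
    angle V 4 ≤ angle W 4 + ε * Real.exp ((2 * (B + 1) + 1) * 4) := by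
  set K := 2 * (B + 1) with hK
  have hB0 : 0 ≤ B := (abs_nonneg _).trans (hB 0 (by norm_num))
  have hexp : ∀ y, HasDerivAt (fun y => ε * Real.exp ((K + 1) * y))
      (ε * (Real.exp ((K + 1) * y) * (K + 1))) y := by
    intro y
    have := ((hasDerivAt_id y).const_mul (K + 1)).exp.const_mul ε
    simpa using this
  refine angle_le hV (g := fun x => angle W x + ε * Real.exp ((K + 1) * x))
    ((angle_continuousOn hW).add (by fun_prop))
    (fun x hx => (angle_deriv hW hx).add (hexp x).hasDerivWithinAt) (fun x hx => ?_)
    (by rw [(angle_spec hW).1]; positivity) 4 (by norm_num)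
  have hx' : x ∈ Icc (0 : ℝ) 4 := ⟨hx.1, hx.2.le⟩
  have h1 := (le_abs_self _).trans (abs_pruferField_sub_le (hB x hx')
    (angle W x + ε * Real.exp ((K + 1) * x)) (angle W x))
  rw [add_sub_cancel_left, abs_of_nonneg (by positivity)] at h1
  have h2 : pruferField V x (angle W x) ≤ pruferField W x (angle W x) + ε := by
    unfold pruferField
    have := h x hx'
    nlinarith [Real.sin_sq_le_one (angle W x), sq_nonneg (Real.sin (angle W x))]
  have h3 : 1 ≤ Real.exp ((K + 1) * x) := Real.one_le_exp (mul_nonneg (by positivity) hx.1)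
  nlinarith

theorem hasDerivAt_arctan_mul (c x : ℝ) :
    HasDerivAt (fun y => Real.arctan (c * y)) (c / (1 + (c * x) ^ 2)) x := by
  have := ((hasDerivAt_id x).const_mul c).arctan
  simp only [id, mul_one] at this
  convert this using 1
  ring

theorem pruferField_arctan (V : ℝ → ℝ) (x s : ℝ) :
    pruferField V x (Real.arctan s) = (1 + V x * s ^ 2) / (1 + s ^ 2) := by
  have : 1 + s ^ 2 ≠ 0 := by positivity
  rw [pruferField, Real.sin_sq_arctan]
  field_simp
  ring

/-- The barrier `arctan (2 * x)` never reaches `π / 2`. It is a supersolution when `1 + V * (2 *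
x)^2 ≤ 2`, and `x ≤ 4` yields the constant `1 / 64`. -/
theorem angle_lt_pi {V : ℝ → ℝ} (hV : Continuous V) (h : ∀ x ∈ Icc (0 : ℝ) 4, V x ≤ 1 / 64) :
    angle V 4 < Real.pi := by
  have := angle_le hV (g := fun x => Real.arctan (2 * x)) (by fun_prop)
    (fun x _ => (hasDerivAt_arctan_mul 2 x).hasDerivWithinAt) (fun x hx => ?_) (by simp) 4
    (by norm_num)
  · exact this.trans_lt ((Real.arctan_lt_pi_div_two _).trans (by linarith [Real.pi_pos]))
  · rw [pruferField_arctan]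
    have h1 := h x ⟨hx.1, hx.2.le⟩
    have h2 : x ^ 2 ≤ 16 := by nlinarith [hx.1, hx.2]
    gcongr
    nlinarith [sq_nonneg x]

theorem angle_pos {V : ℝ → ℝ} (hV : Continuous V) {x : ℝ} (hx : x ∈ Ioc (0 : ℝ) 4) :
    0 < angle V x := by
  obtain ⟨B, hB0, hB⟩ := exists_abs_le_of_continuous hV
  -- Chosen so that `c = 1 - 16 * B * c`, which makes `arctan (c * x)` a subsolution on `[0,4]`.
  set c := 1 / (1 + 16 * B) with hc
  have hc0 : 0 < c := by positivity
  have hc1 : c ≤ 1 := by rw [hc, div_le_one (by positivity)]; linarith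
  have hcB : c * (1 + 16 * B) = 1 := by rw [hc]; field_simp
  have := le_angle hV le_rfl (g := fun x => Real.arctan (c * x)) (by fun_prop)
    (fun x _ => (hasDerivAt_arctan_mul c x).hasDerivWithinAt) (fun y hy => ?_)
    (by rw [(angle_spec hV).1]; simp) x ⟨hx.1.le, hx.2⟩
  · exact (Real.arctan_pos.mpr (mul_pos hc0 hx.1)).trans_le this
  · rw [pruferField_arctan]
    have h1 := neg_le_of_abs_le (hB y ⟨hy.1, hy.2.le⟩)
    have h2 : y ^ 2 ≤ 16 := by nlinarith [hy.1, hy.2]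
    have h3 : (c * y) ^ 2 ≤ c * 16 := by
      calc (c * y) ^ 2 = c * (c * y ^ 2) := by ring
        _ ≤ c * (1 * 16) := by gcongr
        _ = c * 16 := by ring
    gcongr
    nlinarith [sq_nonneg (c * y)]

theorem angle_nonneg {V : ℝ → ℝ} (hV : Continuous V) {x : ℝ} (hx : x ∈ Icc (0 : ℝ) 4) :
    0 ≤ angle V x := by
  rcases hx.1.eq_or_lt with rfl | h
  · exact (angle_spec hV).1.ge
  · exact (angle_pos hV ⟨h, hx.2⟩).le

/-- At height `π` the field equals `1`, whatever `V` is, so the angle can cross this level only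
upwards. -/
theorem pi_le_angle_of_le {V : ℝ → ℝ} (hV : Continuous V) {x : ℝ} (hx : x ∈ Icc (0 : ℝ) 4)
    (h : Real.pi ≤ angle V x) : Real.pi ≤ angle V 4 :=
  le_angle hV hx.1 (g := fun _ => Real.pi) (by fun_prop)
    (fun y _ => (hasDerivAt_const y Real.pi).hasDerivWithinAt)
    (fun y _ => by simp [pruferField]) h 4 ⟨hx.2, le_rfl⟩

/-- Sturm comparison with `sin (w (x - 2 + δ))` on an interval of length `2 δ = π / w`. -/
theorem pi_le_angle {V : ℝ → ℝ} (hV : Continuous V) {δ : ℝ} (hδ : 0 < δ) (hδ2 : δ ≤ 2)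
    (h : ∀ x ∈ Icc (2 - δ) (2 + δ), (Real.pi / (2 * δ)) ^ 2 ≤ V x) : Real.pi ≤ angle V 4 := by
  by_contra! hlt
  have hltx : ∀ x ∈ Icc (0 : ℝ) 4, angle V x < Real.pi := fun x hx => by
    by_contra! hx'
    exact absurd (pi_le_angle_of_le hV hx hx') (not_le.mpr hlt)
  obtain ⟨B, hB0, hB⟩ := exists_abs_le_of_continuous hV
  set w := Real.pi / (2 * δ) with hw
  have hw0 : 0 < w := by positivity
  have hwδ : w * (2 * δ) = Real.pi := by rw [hw]; field_simp
  have hsub : Icc (2 - δ) (2 + δ) ⊆ Icc (0 : ℝ) 4 := Icc_subset_Icc (by linarith) (by linarith)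
  set y := fun x => Real.sin (w * (x - (2 - δ))) with hy
  set z := fun x => w * Real.cos (w * (x - (2 - δ))) with hz
  have harg : ∀ x, HasDerivAt (fun x => w * (x - (2 - δ))) w x := fun x => by
    simpa using ((hasDerivAt_id x).sub_const (2 - δ)).const_mul w
  have hy' : ∀ x, HasDerivAt y (z x) x := fun x => by
    have := (harg x).sin
    exact this.congr_deriv (by simp only [hz]; ring)
  have hz' : ∀ x, HasDerivAt z (-(w ^ 2 * y x)) x := fun x => by
    have := (harg x).cos.const_mul w
    exact this.congr_deriv (by simp only [hy]; ring)
  set θ := angle V with hθ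
  have hycont : Continuous y := by simp only [hy]; fun_prop
  have hzcont : Continuous z := by simp only [hz]; fun_prop
  have hθcont : ContinuousOn θ (Icc (2 - δ) (2 + δ)) := (angle_continuousOn hV).mono hsub
  -- The function `f` is the Wronskian of the solution and the sine, divided by the polar radius. If
  -- the angle stays below `π`, it satisfies a linear differential inequality and starts
  -- nonpositive, yet ends at `w * sin θ > 0`.
  have key := le_of_subsolution_of_supersolution (a := 2 - δ) (b := 2 + δ) (K := B + 1)
    (f := fun x => Real.cos (θ x) * y x - Real.sin (θ x) * z x)
    (f' := fun x => (-Real.sin (θ x) * pruferField V x (θ x)) * y x + Real.cos (θ x) * z x -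
      ((Real.cos (θ x) * pruferField V x (θ x)) * z x + Real.sin (θ x) * -(w ^ 2 * y x)))
    (g := fun _ => 0) (g' := fun _ => 0)
    (F := fun x s => (V x - 1) * Real.sin (θ x) * Real.cos (θ x) * s)
    (by fun_prop)
    (fun x hx => ?_) continuousOn_const (fun x _ => (hasDerivAt_const x (0 : ℝ)).hasDerivWithinAt)
    ?_ ?_ (fun x _ => by simp) ?_ (2 + δ) ⟨by linarith, le_rfl⟩
  · have e1 : w * (2 + δ - (2 - δ)) = Real.pi := by rw [← hwδ]; ring
    simp only [hy, hz, e1, Real.sin_pi, Real.cos_pi] at key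
    have h1 : 0 < θ (2 + δ) := angle_pos hV ⟨by linarith, by linarith⟩
    have h2 : θ (2 + δ) < Real.pi := hltx _ ⟨by linarith, by linarith⟩
    have h3 := Real.sin_pos_of_pos_of_lt_pi h1 h2
    nlinarith
  · have hd := angle_deriv hV (x := x) ⟨by linarith [hx.1], by linarith [hx.2]⟩
    exact (hd.cos.mul (hy' x).hasDerivWithinAt).sub (hd.sin.mul (hz' x).hasDerivWithinAt)
  · intro x hx a b hab
    have hx' := hsub ⟨hx.1, hx.2.le⟩
    have h1 : |(V x - 1) * Real.sin (θ x) * Real.cos (θ x)| ≤ B + 1 := by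
      have h2 : |V x - 1| ≤ B + 1 := (abs_sub _ _).trans (by simpa using hB x hx')
      rw [abs_mul, abs_mul]
      calc |V x - 1| * |Real.sin (θ x)| * |Real.cos (θ x)| ≤ (B + 1) * 1 * 1 := by
            gcongr
            · exact Real.abs_sin_le_one _
            · exact Real.abs_cos_le_one _
        _ = B + 1 := by ring
    rw [← mul_sub]
    exact mul_le_mul_of_nonneg_right ((le_abs_self _).trans h1) (sub_nonneg.mpr hab)
  · intro x hx
    have hx' := hsub ⟨hx.1, hx.2.le⟩
    have h1 := h x ⟨hx.1, hx.2.le⟩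
    have h2 : 0 ≤ Real.sin (θ x) :=
      Real.sin_nonneg_of_nonneg_of_le_pi (angle_nonneg hV hx') (hltx x hx').le
    have h3 : 0 ≤ y x := by
      refine Real.sin_nonneg_of_nonneg_of_le_pi (mul_nonneg hw0.le (by linarith [hx.1])) ?_
      rw [← hwδ]
      have := hx.2
      gcongr
      linarith
    have h4 : (-Real.sin (θ x) * pruferField V x (θ x)) * y x + Real.cos (θ x) * z x -
        ((Real.cos (θ x) * pruferField V x (θ x)) * z x + Real.sin (θ x) * -(w ^ 2 * y x)) =
        (V x - 1) * Real.sin (θ x) * Real.cos (θ x) *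
          (Real.cos (θ x) * y x - Real.sin (θ x) * z x) -
        (V x - w ^ 2) * (Real.sin (θ x) * y x) := by
      have := Real.sin_sq_add_cos_sq (θ x)
      unfold pruferField
      generalize Real.sin (θ x) = s at *
      generalize Real.cos (θ x) = c at *
      have hs : s ^ 2 = 1 - c ^ 2 := by linarith
      linear_combination (s * y x * (1 - V x)) * this
    rw [h4]
    have := mul_nonneg (sub_nonneg.mpr h1) (mul_nonneg h2 h3)
    linarith
  · have h1 : 0 ≤ Real.sin (θ (2 - δ)) := by
      have hm : 2 - δ ∈ Icc (0 : ℝ) 4 := ⟨by linarith, by linarith⟩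
      exact Real.sin_nonneg_of_nonneg_of_le_pi (angle_nonneg hV hm) (hltx _ hm).le
    simp only [hy, hz, sub_self, mul_zero, Real.sin_zero, Real.cos_zero, mul_one, zero_sub]
    nlinarith

/-! ### From the Prüfer angle back to the linear equation. -/

/-- The solution of `u'' + V u = 0`, `u 0 = 0`, `u' 0 = 1` in polar coordinates. -/
theorem exists_polar_solution {V : ℝ → ℝ} (hV : Continuous V) :
    ∃ r : ℝ → ℝ, (∀ x, 0 < r x) ∧ r 0 = 1 ∧
      (∀ x ∈ Icc (0 : ℝ) 4, HasDerivWithinAt (fun x => r x * Real.sin (angle V x))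
        (r x * Real.cos (angle V x)) (Icc 0 4) x) ∧
      (∀ x ∈ Icc (0 : ℝ) 4, HasDerivWithinAt (fun x => r x * Real.cos (angle V x))
        (-(V x * (r x * Real.sin (angle V x)))) (Icc 0 4) x) := by
  have h04 : (0 : ℝ) ≤ 4 := by norm_num
  set θ := IccExtend h04 ((Icc (0 : ℝ) 4).domRestrict (angle V)) with hθ
  have hθc : Continuous θ := (angle_continuousOn hV).domRestrict.Icc_extend'
  have hθe : ∀ x ∈ Icc (0 : ℝ) 4, θ x = angle V x := fun x hx => IccExtend_of_mem _ _ hx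
  -- This is the logarithmic derivative of the radius. The angle was extended constantly beyond
  -- `[0,4]` so that `p` is continuous on the whole line.
  set p := fun x => (1 - V x) * Real.sin (θ x) * Real.cos (θ x) with hp
  have hpc : Continuous p := by simp only [hp]; fun_prop
  refine ⟨fun x => Real.exp (∫ y in (0 : ℝ)..x, p y), fun x => Real.exp_pos _, by simp, ?_, ?_⟩
  all_goals
    intro x hx
    have hr := ((hpc.integral_hasStrictDerivAt 0 x).hasDerivAt.exp).hasDerivWithinAt (s := Icc 0 4)
    have hd := (angle_spec hV).2 x hx
    have hsc := Real.sin_sq_add_cos_sq (angle V x)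
    simp only [hp, hθe x hx] at hr
  · refine (hr.mul hd.sin).congr_deriv ?_
    unfold pruferField
    generalize Real.sin (angle V x) = s at *
    generalize Real.cos (angle V x) = c at *
    ring
  · refine (hr.mul hd.cos).congr_deriv ?_
    unfold pruferField
    generalize Real.sin (angle V x) = s at *
    generalize Real.cos (angle V x) = c at *
    simp only [hp]
    set e := Real.exp _
    linear_combination (e * s * (1 - V x)) * hsc

/-- Uniqueness for the initial value problem of `u'' + V u = 0`. -/
theorem eq_zero_of_initial {V u v : ℝ → ℝ} (hV : Continuous V)
    (hu : ∀ x ∈ Icc (0 : ℝ) 4, HasDerivWithinAt u (v x) (Icc 0 4) x)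
    (hv : ∀ x ∈ Icc (0 : ℝ) 4, HasDerivWithinAt v (-(V x * u x)) (Icc 0 4) x)
    (hu0 : u 0 = 0) (hv0 : v 0 = 0) : ∀ x ∈ Icc (0 : ℝ) 4, u x = 0 := by
  obtain ⟨B, hB0, hB⟩ := exists_abs_le_of_continuous hV
  have key := le_of_subsolution_of_supersolution (a := 0) (b := 4) (K := B + 1)
    (f := fun x => u x ^ 2 + v x ^ 2)
    (f' := fun x => 2 * u x * v x + 2 * v x * -(V x * u x))
    (g := fun _ => 0) (g' := fun _ => 0) (F := fun _ w => (B + 1) * w)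
    (fun x hx => ((hu x hx).continuousWithinAt.pow 2).add ((hv x hx).continuousWithinAt.pow 2))
    (fun x hx => ?_) continuousOn_const (fun x _ => (hasDerivAt_const x (0 : ℝ)).hasDerivWithinAt)
    (fun x _ y z _ => by rw [mul_sub]) (fun x hx => ?_) (fun x _ => by simp)
    (by simp [hu0, hv0])
  · intro x hx
    have : u x ^ 2 + v x ^ 2 ≤ 0 := key x hx
    nlinarith [sq_nonneg (u x), sq_nonneg (v x)]
  · have hx' : x ∈ Icc (0 : ℝ) 4 := ⟨hx.1, hx.2.le⟩
    have h1 := HasDerivWithinAt.Ici_of_Icc (hu x hx') hx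
    have h2 := HasDerivWithinAt.Ici_of_Icc (hv x hx') hx
    exact ((h1.pow 2).add (h2.pow 2)).congr_deriv (by simp)
  · have hx' : x ∈ Icc (0 : ℝ) 4 := ⟨hx.1, hx.2.le⟩
    have h1 := abs_le.mp (hB x hx')
    have h2 : 2 * |u x * v x| ≤ u x ^ 2 + v x ^ 2 := by
      rw [abs_mul]
      nlinarith [sq_nonneg (|u x| - |v x|), sq_abs (u x), sq_abs (v x)]
    have h3 : |1 - V x| ≤ B + 1 := abs_le.mpr ⟨by linarith, by linarith⟩
    calc 2 * u x * v x + 2 * v x * -(V x * u x) = (1 - V x) * (2 * (u x * v x)) := by ring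
      _ ≤ |(1 - V x) * (2 * (u x * v x))| := le_abs_self _
      _ = |1 - V x| * (2 * |u x * v x|) := by rw [abs_mul, abs_mul]; norm_num
      _ ≤ (B + 1) * (u x ^ 2 + v x ^ 2) := by gcongr

/-! ### The first eigenvalue as the threshold at which the Prüfer angle reaches `π`. -/

/-- The potential `λ Q - m²`. -/
def potential (Q : ℝ → ℝ) (m : ℕ) (lam : ℝ) (x : ℝ) : ℝ := lam * Q x - (m : ℝ) ^ 2

/-- The parameters `λ` for which the Prüfer angle of `λ Q - m²` reaches `π` on `[0,4]`. -/
def oscSet (Q : ℝ → ℝ) (m : ℕ) : Set ℝ := {lam | Real.pi ≤ angle (potential Q m lam) 4}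

/-- The infimum of `oscSet`, which is the first Dirichlet eigenvalue. -/
def firstEigenvalue (Q : ℝ → ℝ) (m : ℕ) : ℝ := sInf (oscSet Q m)

variable {Q : ℝ → ℝ} {m : ℕ}

theorem continuous_potential (hQ : Continuous Q) (lam : ℝ) : Continuous (potential Q m lam) := by
  unfold potential; fun_prop

/-- By uniqueness an eigenfunction is a multiple of the polar solution, which does not vanish at `4`
when the final angle lies strictly between `0` and `π`. -/
theorem mem_oscSet_of_eigenvalue (hQ : Continuous Q) {lam : ℝ}
    (h : IsDirichletEigenvalue Q m lam) : lam ∈ oscSet Q m := by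
  obtain ⟨u, v, hu, hv, hu0, hu4, x, hx, hne⟩ := h
  have hV := continuous_potential (m := m) hQ lam
  by_contra hlt
  have hlt : angle (potential Q m lam) 4 < Real.pi := not_le.mp hlt
  have hsin := Real.sin_pos_of_pos_of_lt_pi (angle_pos hV (x := 4) (by norm_num)) hlt
  obtain ⟨r, hr, hr0, hy, hz⟩ := exists_polar_solution hV
  have key := eq_zero_of_initial hV (u := fun x => u x - v 0 * (r x *
      Real.sin (angle (potential Q m lam) x)))
    (v := fun x => v x - v 0 * (r x * Real.cos (angle (potential Q m lam) x)))
    (fun x hx => (hu x hx).sub ((hy x hx).const_mul _))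
    (fun x hx => by
      refine ((hv x hx).sub ((hz x hx).const_mul (v 0))).congr_deriv ?_
      unfold potential; ring)
    (by simp [hu0, (angle_spec hV).1]) (by simp [hr0, (angle_spec hV).1])
  have h4 := key 4 (by norm_num)
  simp only [hu4, zero_sub, neg_eq_zero, mul_eq_zero, (hr 4).ne', hsin.ne', or_false] at h4
  have hx0 := key x hx
  simp only [h4, zero_mul, sub_zero] at hx0
  exact hne hx0

theorem eigenvalue_of_angle_eq_pi (hQ : Continuous Q) {lam : ℝ}
    (h : angle (potential Q m lam) 4 = Real.pi) : IsDirichletEigenvalue Q m lam := by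
  have hV := continuous_potential (m := m) hQ lam
  obtain ⟨r, hr, hr0, hy, hz⟩ := exists_polar_solution hV
  refine ⟨_, _, hy, hz, by simp [(angle_spec hV).1], by simp [h], ?_⟩
  have hmid : Real.pi / 2 ∈ Icc (angle (potential Q m lam) 0) (angle (potential Q m lam) 4) := by
    rw [(angle_spec hV).1, h]
    constructor <;> linarith [Real.pi_pos]
  obtain ⟨x, hx, hxe⟩ := intermediate_value_Icc (by norm_num) (angle_continuousOn hV) hmid
  refine ⟨x, hx, ?_⟩
  simp [hxe, (hr x).ne']

theorem mem_oscSet_of_le {P : ℝ → ℝ} (hP : Continuous P) (hQ : Continuous Q) {lam mu : ℝ}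
    (h : ∀ x ∈ Icc (0 : ℝ) 4, lam * P x ≤ mu * Q x) (hl : lam ∈ oscSet P m) : mu ∈ oscSet Q m :=
  le_trans (show Real.pi ≤ _ from hl) (angle_mono (continuous_potential hP _)
    (continuous_potential hQ _) fun x hx => sub_le_sub_right (h x hx) _)

theorem lower_bound_of_mem_oscSet (hQ : Continuous Q) {M lam : ℝ} (hM : 0 < M)
    (hpos : ∀ x ∈ Icc (0 : ℝ) 4, 0 < Q x) (h : ∀ x ∈ Icc (0 : ℝ) 4, Q x ≤ M)
    (hl : lam ∈ oscSet Q m) : ((m : ℝ) ^ 2 + 1 / 64) / M ≤ lam := by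
  by_contra! hlt
  refine absurd (angle_lt_pi (continuous_potential (m := m) hQ lam) fun x hx => ?_) (not_lt.mpr hl)
  rw [lt_div_iff₀ hM] at hlt
  unfold potential
  rcases le_total 0 lam with h0 | h0
  · nlinarith [h x hx]
  · nlinarith [hpos x hx, sq_nonneg (m : ℝ)]

theorem mem_oscSet_of_ge (hQ : Continuous Q) {c δ : ℝ} (hc : 0 < c) (hδ : 0 < δ) (hδ2 : δ ≤ 2)
    (h : ∀ x ∈ Icc (2 - δ) (2 + δ), c ≤ Q x) :
    ((m : ℝ) ^ 2 + (Real.pi / (2 * δ)) ^ 2) / c ∈ oscSet Q m := by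
  refine pi_le_angle (continuous_potential hQ _) hδ hδ2 fun x hx => ?_
  have h1 : ((m : ℝ) ^ 2 + (Real.pi / (2 * δ)) ^ 2) / c * c =
      (m : ℝ) ^ 2 + (Real.pi / (2 * δ)) ^ 2 := div_mul_cancel₀ _ hc.ne'
  have h2 : ((m : ℝ) ^ 2 + (Real.pi / (2 * δ)) ^ 2) / c * c ≤
      ((m : ℝ) ^ 2 + (Real.pi / (2 * δ)) ^ 2) / c * Q x :=
    mul_le_mul_of_nonneg_left (h x hx) (by positivity)
  unfold potential
  linarith

theorem exists_pos_bounds (hQ : Continuous Q) (hpos : ∀ x ∈ Icc (0 : ℝ) 4, 0 < Q x) :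
    ∃ c M : ℝ, 0 < c ∧ 0 < M ∧ ∀ x ∈ Icc (0 : ℝ) 4, c ≤ Q x ∧ Q x ≤ M := by
  have hne : (Icc (0 : ℝ) 4).Nonempty := ⟨0, by norm_num⟩
  obtain ⟨a, ha, hmin⟩ := isCompact_Icc.exists_isMinOn hne hQ.continuousOn
  obtain ⟨b, hb, hmax⟩ := isCompact_Icc.exists_isMaxOn hne hQ.continuousOn
  exact ⟨Q a, Q b, hpos a ha, hpos b hb, fun x hx => ⟨hmin hx, hmax hx⟩⟩

theorem oscSet_nonempty (hQ : Continuous Q) (hpos : ∀ x ∈ Icc (0 : ℝ) 4, 0 < Q x) :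
    (oscSet Q m).Nonempty := by
  obtain ⟨c, M, hc, hM, h⟩ := exists_pos_bounds hQ hpos
  exact ⟨_, mem_oscSet_of_ge hQ hc two_pos le_rfl fun x hx =>
    (h x ⟨by linarith [hx.1], by linarith [hx.2]⟩).1⟩

theorem oscSet_bddBelow (hQ : Continuous Q) (hpos : ∀ x ∈ Icc (0 : ℝ) 4, 0 < Q x) :
    BddBelow (oscSet Q m) := by
  obtain ⟨c, M, hc, hM, h⟩ := exists_pos_bounds hQ hpos
  exact ⟨_, fun x hx => lower_bound_of_mem_oscSet hQ hM hpos (fun y hy => (h y hy).2) hx⟩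

theorem firstEigenvalue_pos (hQ : Continuous Q) (hpos : ∀ x ∈ Icc (0 : ℝ) 4, 0 < Q x) :
    0 < firstEigenvalue Q m := by
  obtain ⟨c, M, hc, hM, h⟩ := exists_pos_bounds hQ hpos
  refine lt_of_lt_of_le ?_ (le_csInf (oscSet_nonempty hQ hpos)
    fun x hx => lower_bound_of_mem_oscSet hQ hM hpos (fun y hy => (h y hy).2) hx)
  positivity

/-- The Prüfer angle depends continuously on the spectral parameter. -/
theorem angle_potential_le_add (hQ : Continuous Q) (hpos : ∀ x ∈ Icc (0 : ℝ) 4, 0 < Q x) (L : ℝ) :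
    ∃ C > 0, ∀ lam mu, |lam| ≤ L → angle (potential Q m lam) 4 ≤
      angle (potential Q m mu) 4 + |lam - mu| * C := by
  obtain ⟨c, M, hc, hM, h⟩ := exists_pos_bounds hQ hpos
  refine ⟨M * Real.exp ((2 * ((L * M + (m : ℝ) ^ 2) + 1) + 1) * 4), by positivity,
    fun lam mu hl => ?_⟩
  rw [← mul_assoc]
  refine angle_le_add (continuous_potential hQ _) (continuous_potential hQ _) (fun x hx => ?_)
    (by positivity) (fun x hx => ?_)
  · refine (abs_sub _ _).trans (add_le_add ?_ (by rw [abs_of_nonneg (by positivity)]))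
    rw [abs_mul, abs_of_pos (hpos x hx)]
    exact mul_le_mul hl (h x hx).2 (hpos x hx).le ((abs_nonneg _).trans hl)
  · have h1 : (lam - mu) * Q x ≤ |lam - mu| * M :=
      mul_le_mul (le_abs_self _) (h x hx).2 (hpos x hx).le (abs_nonneg _)
    unfold potential
    linarith

/-- The final angle is Lipschitz in the spectral parameter on bounded sets. Above `π` one could
lower the parameter further; below `π`, no nearby parameter would lie in `oscSet`. -/
theorem angle_firstEigenvalue (hQ : Continuous Q) (hpos : ∀ x ∈ Icc (0 : ℝ) 4, 0 < Q x) :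
    angle (potential Q m (firstEigenvalue Q m)) 4 = Real.pi := by
  set Λ := firstEigenvalue Q m with hΛ
  have hΛ0 : 0 < Λ := firstEigenvalue_pos hQ hpos
  obtain ⟨C, hC, hcont⟩ := angle_potential_le_add (m := m) hQ hpos (Λ + 1)
  refine le_antisymm ?_ ?_
  · by_contra! hgt
    set g := angle (potential Q m Λ) 4 - Real.pi with hg
    have hη : 0 < g / C := div_pos (by linarith) hC
    have h1 := hcont Λ (Λ - g / C) (by rw [abs_of_pos hΛ0]; linarith)
    rw [sub_sub_cancel, abs_of_pos hη, div_mul_cancel₀ _ hC.ne'] at h1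
    have h2 : Λ - g / C ∈ oscSet Q m := show Real.pi ≤ _ by linarith
    have h3 := csInf_le (oscSet_bddBelow hQ hpos) h2
    change Λ ≤ _ at h3
    linarith
  · by_contra! hlt
    set g := Real.pi - angle (potential Q m Λ) 4 with hg
    have hη : 0 < min 1 (g / C) := lt_min one_pos (div_pos (by linarith) hC)
    obtain ⟨lam, hlam, hlt'⟩ := exists_lt_of_csInf_lt (oscSet_nonempty (m := m) hQ hpos)
      (show sInf (oscSet Q m) < Λ + min 1 (g / C) by change Λ < _; linarith)
    have h0 : Λ ≤ lam := csInf_le (oscSet_bddBelow hQ hpos) hlam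
    have h1 := hcont lam Λ (by
      rw [abs_of_pos (hΛ0.trans_le h0)]
      linarith [min_le_left 1 (g / C)])
    rw [abs_of_nonneg (by linarith)] at h1
    have h2 : (lam - Λ) * C < g := by
      rw [← lt_div_iff₀ hC]
      linarith [min_le_right 1 (g / C)]
    have h3 : Real.pi ≤ angle (potential Q m lam) 4 := hlam
    linarith

theorem firstEigenvalue_mem (hQ : Continuous Q) (hpos : ∀ x ∈ Icc (0 : ℝ) 4, 0 < Q x) :
    firstEigenvalue Q m ∈ oscSet Q m :=
  (angle_firstEigenvalue hQ hpos).ge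

theorem isFirstDirichletEigenvalue_firstEigenvalue (hQ : Continuous Q)
    (hpos : ∀ x ∈ Icc (0 : ℝ) 4, 0 < Q x) :
    IsFirstDirichletEigenvalue Q m (firstEigenvalue Q m) :=
  ⟨eigenvalue_of_angle_eq_pi hQ (angle_firstEigenvalue hQ hpos),
    fun _ hl => csInf_le (oscSet_bddBelow hQ hpos) (mem_oscSet_of_eigenvalue hQ hl)⟩

/-- Comparison of first eigenvalues of two weights. -/
theorem firstEigenvalue_le {P : ℝ → ℝ} (hP : Continuous P) (hQ : Continuous Q)
    (hPpos : ∀ x ∈ Icc (0 : ℝ) 4, 0 < P x) (hpos : ∀ x ∈ Icc (0 : ℝ) 4, 0 < Q x) {mu : ℝ}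
    (h : ∀ x ∈ Icc (0 : ℝ) 4, firstEigenvalue P m * P x ≤ mu * Q x) : firstEigenvalue Q m ≤ mu :=
  csInf_le (oscSet_bddBelow hQ hpos) (mem_oscSet_of_le hP hQ h (firstEigenvalue_mem hP hPpos))

theorem le_firstEigenvalue_of_le (hQ : Continuous Q) (hpos : ∀ x ∈ Icc (0 : ℝ) 4, 0 < Q x) {M : ℝ}
    (hM : 0 < M) (h : ∀ x ∈ Icc (0 : ℝ) 4, Q x ≤ M) :
    ((m : ℝ) ^ 2 + 1 / 64) / M ≤ firstEigenvalue Q m :=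
  lower_bound_of_mem_oscSet hQ hM hpos h (firstEigenvalue_mem hQ hpos)

theorem firstEigenvalue_le_of_ge (hQ : Continuous Q) (hpos : ∀ x ∈ Icc (0 : ℝ) 4, 0 < Q x)
    {c δ : ℝ} (hc : 0 < c) (hδ : 0 < δ) (hδ2 : δ ≤ 2) (h : ∀ x ∈ Icc (2 - δ) (2 + δ), c ≤ Q x) :
    firstEigenvalue Q m ≤ ((m : ℝ) ^ 2 + (Real.pi / (2 * δ)) ^ 2) / c :=
  csInf_le (oscSet_bddBelow hQ hpos) (mem_oscSet_of_ge hQ hc hδ hδ2 h)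

/-- The first eigenvalue is continuous with respect to uniform convergence of the weight. -/
theorem tendsto_firstEigenvalue {α : Type*} {l : Filter α} {P : α → ℝ → ℝ}
    (hP : ∀ a, Continuous (P a)) (hPpos : ∀ a, ∀ x ∈ Icc (0 : ℝ) 4, 0 < P a x)
    (hQ : Continuous Q) (hpos : ∀ x ∈ Icc (0 : ℝ) 4, 0 < Q x)
    (h : TendstoUniformlyOn P Q l (Icc 0 4)) :
    Tendsto (fun a => firstEigenvalue (P a) m) l (𝓝 (firstEigenvalue Q m)) := by
  obtain ⟨c, M, hc, hM, hcM⟩ := exists_pos_bounds hQ hpos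
  set Λ := firstEigenvalue Q m with hΛ
  have hΛ0 : 0 < Λ := firstEigenvalue_pos hQ hpos
  -- Since `Q` is bounded below by `c`, uniform closeness is relative closeness up to the factor `1
  -- - ε`; monotonicity in `λ * Q` transfers that factor to the eigenvalues.
  have hev : ∀ ε : ℝ, 0 < ε → ε < 1 → ∀ᶠ a in l,
      Λ * (1 - ε) ≤ firstEigenvalue (P a) m ∧ firstEigenvalue (P a) m ≤ Λ / (1 - ε) := by
    intro ε hε hε1
    filter_upwards [Metric.tendstoUniformlyOn_iff.mp h (ε * c) (by positivity)] with a ha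
    have hb : ∀ x ∈ Icc (0 : ℝ) 4, (1 - ε) * Q x ≤ P a x ∧ (1 - ε) * P a x ≤ Q x := by
      intro x hx
      have h1 := ha x hx
      rw [Real.dist_eq, abs_lt] at h1
      have h2 := (hcM x hx).1
      have h3 : ε * c ≤ ε * Q x := by gcongr
      refine ⟨by linarith, ?_⟩
      have h4 : P a x ≤ (1 + ε) * Q x := by linarith
      have h5 : (1 - ε) * P a x ≤ (1 - ε) * ((1 + ε) * Q x) :=
        mul_le_mul_of_nonneg_left h4 (by linarith)
      nlinarith [hpos x hx, mul_pos hε hε]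
    have he : 0 < 1 - ε := by linarith
    constructor
    · have hpa : 0 < firstEigenvalue (P a) m := firstEigenvalue_pos (hP a) (hPpos a)
      rw [← le_div_iff₀ he]
      refine firstEigenvalue_le (hP a) hQ (hPpos a) hpos fun x hx => ?_
      rw [div_mul_eq_mul_div, le_div_iff₀ he, mul_assoc]
      exact mul_le_mul_of_nonneg_left (by linarith [(hb x hx).2]) hpa.le
    · refine firstEigenvalue_le hQ (hP a) hpos (hPpos a) fun x hx => ?_
      rw [div_mul_eq_mul_div, le_div_iff₀ he, mul_assoc]
      exact mul_le_mul_of_nonneg_left (by linarith [(hb x hx).1]) hΛ0.le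
  have hl1 : Tendsto (fun ε : ℝ => Λ * (1 - ε)) (𝓝[>] 0) (𝓝 Λ) := by
    have : ContinuousAt (fun ε : ℝ => Λ * (1 - ε)) 0 := by fun_prop
    simpa using this.tendsto.mono_left nhdsWithin_le_nhds
  have hl2 : Tendsto (fun ε : ℝ => Λ / (1 - ε)) (𝓝[>] 0) (𝓝 Λ) := by
    have : ContinuousAt (fun ε : ℝ => Λ / (1 - ε)) 0 :=
      continuousAt_const.div (by fun_prop) (by norm_num)
    simpa using this.tendsto.mono_left nhdsWithin_le_nhds
  have hsmall : ∀ᶠ ε : ℝ in 𝓝[>] 0, 0 < ε ∧ ε < 1 := Ioo_mem_nhdsGT one_pos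
  rw [tendsto_order]
  constructor
  · intro a ha
    obtain ⟨ε, ⟨h1, h2⟩, h3⟩ := (hsmall.and (hl1.eventually_const_lt ha)).exists
    filter_upwards [hev ε h1 h2] with b hb
    exact h3.trans_le hb.1
  · intro a ha
    obtain ⟨ε, ⟨h1, h2⟩, h3⟩ := (hsmall.and (hl2.eventually_lt_const ha)).exists
    filter_upwards [hev ε h1 h2] with b hb
    exact hb.2.trans_lt h3

/-! ### Rescaled periodizations -/

theorem four_rpow_pos (t : ℝ) : (0 : ℝ) < 4 ^ t := Real.rpow_pos_of_pos (by norm_num) t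

theorem four_rpow_mul_neg (t : ℝ) : (4 : ℝ) ^ t * 4 ^ (-t) = 1 := by
  rw [← Real.rpow_add (by norm_num)]; simp

theorem four_le_rpow {t : ℝ} (ht : 1 ≤ t) : (4 : ℝ) ≤ 4 ^ t := by
  simpa using Real.rpow_le_rpow_of_exponent_le (x := 4) (by norm_num) ht

theorem four_rpow_neg_mem {t : ℝ} (ht : 0 ≤ t) : (4 : ℝ) ^ (-t) ∈ Icc (0 : ℝ) 1 :=
  ⟨(four_rpow_pos _).le, Real.rpow_le_one_of_one_le_of_nonpos (by norm_num) (by linarith)⟩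

theorem exists_eq_add_int_mul_two (x : ℝ) : ∃ y ∈ Icc (-1 : ℝ) 1, ∃ k : ℤ, x = y + k * 2 := by
  refine ⟨x - ⌊(x + 1) / 2⌋ * 2, ⟨?_, ?_⟩, ⌊(x + 1) / 2⌋, by ring⟩
  · linarith [Int.floor_le ((x + 1) / 2)]
  · linarith [Int.lt_floor_add_one ((x + 1) / 2)]

/-- `f` vanishes outside the annulus `1/4 < |y| < 1`. -/
def SuppAnnulus (f : ℝ → ℝ) : Prop := ∀ y, f y ≠ 0 → 1 / 4 < |y| ∧ |y| < 1

variable {f g : ℝ → ℝ}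

/-- For `n ≠ 0` one has `|x + 2 * n| ≥ 1 / 4`, which `4^t ≥ 4` moves out of the support. The bound
`7 / 4` leaves a margin around `[-1,1]`, so the identity can be differentiated there. -/
theorem periodize_eq (hf : SuppAnnulus f) {t x : ℝ} (ht : 1 ≤ t) (hx : |x| ≤ 7 / 4) :
    periodize f t x = f (4 ^ t * x) := by
  unfold periodize
  rw [tsum_eq_single 0]
  · simp
  · intro n hn
    by_contra hne
    have h1 := (hf _ hne).2
    rw [abs_mul, abs_of_pos (four_rpow_pos t)] at h1
    have h2 : (1 : ℝ) ≤ |(n : ℝ)| := by exact_mod_cast Int.one_le_abs hn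
    have h3 : |2 * (n : ℝ)| ≤ |x + 2 * n| + |x| := by
      have := abs_sub (x + 2 * (n : ℝ)) x
      rwa [add_sub_cancel_left] at this
    rw [abs_mul, abs_two] at h3
    nlinarith [four_le_rpow ht, abs_nonneg (x + 2 * n)]

theorem periodize_periodic (f : ℝ → ℝ) (t : ℝ) : Function.Periodic (periodize f t) 2 := by
  intro x
  unfold periodize
  rw [← (Equiv.addRight (1 : ℤ)).tsum_eq fun n : ℤ => f (4 ^ t * (x + 2 * (n : ℝ)))]
  congr 1
  funext n
  simp only [Equiv.coe_addRight, Int.cast_add, Int.cast_one]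
  congr 2
  ring

theorem contDiff_periodize (hf : SuppAnnulus f) (hs : ContDiff ℝ ∞ f) {t : ℝ} (ht : 1 ≤ t) :
    ContDiff ℝ ∞ (periodize f t) := by
  rw [contDiff_iff_contDiffAt]
  intro x
  obtain ⟨y, hy, k, rfl⟩ := exists_eq_add_int_mul_two x
  have hc : ContDiffAt ℝ ∞ (fun z => f (4 ^ t * (z - k * 2))) (y + k * 2) := by
    have : ContDiff ℝ ∞ (fun z : ℝ => f (4 ^ t * (z - k * 2))) := hs.comp (by fun_prop)
    exact this.contDiffAt
  refine hc.congr_of_eventuallyEq ?_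
  have hmem : Icc (y + k * 2 - 3 / 4) (y + k * 2 + 3 / 4) ∈ 𝓝 (y + k * 2) :=
    Icc_mem_nhds (by linarith) (by linarith)
  filter_upwards [hmem] with z hz
  rw [← periodize_eq hf ht (abs_le.mpr ⟨by linarith [hz.1, hy.1], by linarith [hz.2, hy.2]⟩),
    (periodize_periodic f t).sub_int_mul_eq]

theorem iteratedDeriv_periodic (hf : Function.Periodic f 2) (n : ℕ) :
    Function.Periodic (iteratedDeriv n f) 2 := by
  intro x
  have h := congrFun (iteratedDeriv_comp_add_const n f 2) x
  have h2 : (fun z => f (z + 2)) = f := funext hf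
  rw [h2] at h
  exact h.symm

theorem exists_bound_iteratedDeriv (hf : Function.Periodic f 2) (hs : ContDiff ℝ ∞ f) (n : ℕ) :
    ∃ C, ∀ x, |iteratedDeriv n f x| ≤ C := by
  obtain ⟨C, hC⟩ := isCompact_Icc.exists_bound_of_continuousOn (s := Icc (-1 : ℝ) 1)
    (hs.continuous_iteratedDeriv n (by exact_mod_cast le_top)).continuousOn
  refine ⟨C, fun x => ?_⟩
  obtain ⟨y, hy, k, rfl⟩ := exists_eq_add_int_mul_two x
  rw [(iteratedDeriv_periodic hf n).int_mul k y]
  exact hC y hy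

/-- Each derivative costs a factor `4^t ≤ 4^b`. Uniformity over `t ≤ b` permits fixing the amplitude
before the scale. -/
theorem exists_bound_iteratedDeriv_periodize (hf : SuppAnnulus f) (hs : ContDiff ℝ ∞ f) (b : ℝ)
    (n : ℕ) : ∃ C, ∀ t ∈ Icc 1 b, ∀ x, |iteratedDeriv n (periodize f t) x| ≤ C := by
  obtain ⟨C, hC⟩ := isCompact_Icc.exists_bound_of_continuousOn
    (s := Icc (-(4 : ℝ) ^ b) ((4 : ℝ) ^ b))
    (hs.continuous_iteratedDeriv n (by exact_mod_cast le_top)).continuousOn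
  have hC0 : 0 ≤ C := (norm_nonneg _).trans
    (hC 0 ⟨by linarith [four_rpow_pos b], (four_rpow_pos b).le⟩)
  refine ⟨(4 ^ b) ^ n * C, fun t ht x => ?_⟩
  obtain ⟨y, hy, k, rfl⟩ := exists_eq_add_int_mul_two x
  rw [(iteratedDeriv_periodic (periodize_periodic f t) n).int_mul k y]
  have hev : periodize f t =ᶠ[𝓝 y] fun z => f (4 ^ t * z) := by
    have hmem : Icc (y - 3 / 4) (y + 3 / 4) ∈ 𝓝 y := Icc_mem_nhds (by linarith) (by linarith)
    filter_upwards [hmem] with z hz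
    exact periodize_eq hf ht.1 (abs_le.mpr ⟨by linarith [hz.1, hy.1], by linarith [hz.2, hy.2]⟩)
  have hle : (4 : ℝ) ^ t ≤ 4 ^ b := Real.rpow_le_rpow_of_exponent_le (by norm_num) ht.2
  rw [hev.iteratedDeriv_eq n, iteratedDeriv_comp_const_mul (hs.of_le (by exact_mod_cast le_top))]
  simp only [abs_mul, abs_pow, abs_of_pos (four_rpow_pos t)]
  have hmem : 4 ^ t * y ∈ Icc (-(4 : ℝ) ^ b) ((4 : ℝ) ^ b) := by
    constructor <;> nlinarith [hy.1, hy.2, four_rpow_pos t]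
  have := hC _ hmem
  rw [Real.norm_eq_abs] at this
  have h4 := four_rpow_pos t
  gcongr

theorem continuousOn_periodize (hf : SuppAnnulus f) (hs : Continuous f) :
    ContinuousOn (fun p : ℝ × ℝ => periodize f p.1 p.2) (Ici 1 ×ˢ Icc 0 4) := by
  have h1 : ContinuousOn (fun p : ℝ × ℝ => ∑ n ∈ Finset.Icc (-4 : ℤ) 4,
      f ((4 : ℝ) ^ p.1 * (p.2 + 2 * (n : ℝ)))) (Ici 1 ×ˢ Icc 0 4) := by
    refine Continuous.continuousOn (continuous_finsetSum _ fun n _ => hs.comp ?_)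
    exact ((Real.continuous_const_rpow (by norm_num)).comp continuous_fst).mul (by fun_prop)
  refine h1.congr fun p hp => ?_
  obtain ⟨ht, hx⟩ := hp
  refine tsum_eq_sum fun n hn => ?_
  by_contra hne
  have h2 := (hf _ hne).2
  rw [abs_mul, abs_of_pos (four_rpow_pos _)] at h2
  have h3 := four_le_rpow ht
  have h4 : |p.2 + 2 * (n : ℝ)| < 1 := by nlinarith [abs_nonneg (p.2 + 2 * (n : ℝ))]
  rw [abs_lt] at h4
  refine hn (Finset.mem_Icc.mpr ⟨?_, ?_⟩)
  · have : (-5 : ℝ) < n := by linarith [hx.2]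
    have : (-5 : ℤ) < n := by exact_mod_cast this
    omega
  · have : (n : ℝ) < 5 := by linarith [hx.1]
    have : n < (5 : ℤ) := by exact_mod_cast this
    omega

/-- The annulus has ratio of radii exactly `4`, so rescalings by exponents at distance at least one
are disjoint. -/
theorem periodize_eq_zero_of_ne_zero (hf : SuppAnnulus f) (hg : SuppAnnulus g) {s t x : ℝ}
    (hs : 1 ≤ s) (ht : 1 ≤ t) (hst : 1 ≤ |s - t|) (hx : periodize f s x ≠ 0) :
    periodize g t x = 0 := by
  obtain ⟨y, hy, k, rfl⟩ := exists_eq_add_int_mul_two x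
  rw [(periodize_periodic _ _).int_mul k y] at hx ⊢
  have hy' : |y| ≤ 7 / 4 := (abs_le.mpr hy).trans (by norm_num)
  rw [periodize_eq hf hs hy'] at hx
  rw [periodize_eq hg ht hy']
  by_contra hne
  have h1 := hf _ hx
  have h2 := hg _ hne
  rw [abs_mul, abs_of_pos (four_rpow_pos _)] at h1 h2
  have aux : ∀ u v : ℝ, u + 1 ≤ v → (4 : ℝ) ^ u * 4 ≤ 4 ^ v := fun u v huv => by
    have := Real.rpow_le_rpow_of_exponent_le (x := 4) (by norm_num) huv
    rwa [Real.rpow_add (by norm_num), Real.rpow_one] at this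
  rcases le_abs.mp hst with h | h
  · nlinarith [aux t s (by linarith), abs_nonneg y]
  · nlinarith [aux s t (by linarith), abs_nonneg y]

theorem periodize_rpow_neg_eq_zero (hf : SuppAnnulus f) {s t : ℝ} (hs : 1 ≤ s) (ht : 1 ≤ t)
    (hst : 1 ≤ |s - t|) : periodize f s (4 ^ (-t)) = 0 := by
  have hm := four_rpow_neg_mem (t := t) (by linarith)
  rw [periodize_eq hf hs (by rw [abs_of_nonneg hm.1]; linarith [hm.2]),
    ← Real.rpow_add (by norm_num)]
  by_contra hne
  have h := hf _ hne
  rw [abs_of_pos (four_rpow_pos _)] at h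
  rcases le_abs.mp hst with h' | h'
  · linarith [four_le_rpow (t := s + -t) (by linarith), h.2]
  · have h1 : (4 : ℝ) ^ (s + -t) ≤ 4 ^ (-1 : ℝ) :=
      Real.rpow_le_rpow_of_exponent_le (by norm_num) (by linarith)
    rw [Real.rpow_neg_one] at h1
    linarith [h.1]

/-! ### The correction terms -/

/-- The difference `q_t - q`. -/
def dent (ψ q : ℝ → ℝ) (t x : ℝ) : ℝ := -(periodize ψ t x * (q x - q (4 ^ (-t))))

/-- The term which the step with parameters `t`, `c` adds to `q`. -/
def correction (ψ q h : ℝ → ℝ) (t c x : ℝ) : ℝ := dent ψ q t x + c * periodize h t x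

variable {ψ q h : ℝ → ℝ}

theorem step_eq (t c : ℝ) (g : ℝ → ℝ) (x : ℝ) : step ψ h t c g x =
    g x - periodize ψ t x * (g x - g (4 ^ (-t))) + c * periodize h t x := by
  unfold step pinch phi; ring

/-- The other corrections vanish both at the reference point `4^(-t)` and wherever the cutoff at
scale `t` is active. Each step therefore adds exactly what it would add to `q` itself. -/
theorem foldr_step_eq (hψ : SuppAnnulus ψ) (hh : SuppAnnulus h) (τ : ℝ → ℝ) (L : List ℝ)
    (h1 : ∀ s ∈ L, 1 ≤ s) (h2 : L.Pairwise fun s t => 1 ≤ |s - t|) :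
    L.foldr (fun t g => step ψ h t (τ t) g) q =
      fun x => q x + (L.map fun s => correction ψ q h s (τ s) x).sum := by
  induction L with
  | nil => simp
  | cons t L ih =>
    rw [List.pairwise_cons] at h2
    have ht := h1 t (by simp)
    have hL : ∀ s ∈ L, 1 ≤ s := fun s hs => h1 s (by simp [hs])
    rw [List.foldr_cons, ih hL h2.2]
    funext x
    have hpt : (L.map fun s => correction ψ q h s (τ s) (4 ^ (-t))).sum = 0 := by
      refine List.sum_eq_zero fun y hy => ?_
      obtain ⟨s, hs, rfl⟩ := List.mem_map.mp hy
      have hst : 1 ≤ |s - t| := by rw [abs_sub_comm]; exact h2.1 s hs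
      simp [correction, dent, periodize_rpow_neg_eq_zero hψ (hL s hs) ht hst,
        periodize_rpow_neg_eq_zero hh (hL s hs) ht hst]
    rw [step_eq, hpt, List.map_cons, List.sum_cons, correction, dent]
    by_cases hx : periodize ψ t x = 0
    · rw [hx]; ring
    · have hx0 : (L.map fun s => correction ψ q h s (τ s) x).sum = 0 := by
        refine List.sum_eq_zero fun y hy => ?_
        obtain ⟨s, hs, rfl⟩ := List.mem_map.mp hy
        simp [correction, dent, periodize_eq_zero_of_ne_zero hψ hψ ht (hL s hs) (h2.1 s hs) hx,
          periodize_eq_zero_of_ne_zero hψ hh ht (hL s hs) (h2.1 s hs) hx]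
      rw [hx0]; ring

theorem qFin_eq (hψ : SuppAnnulus ψ) (hh : SuppAnnulus h) (τ : ℝ → ℝ) (F : Finset ℝ)
    (h1 : ∀ s ∈ F, 1 ≤ s) (h2 : ∀ s ∈ F, ∀ t ∈ F, s ≠ t → 1 ≤ |s - t|) :
    qFin ψ q h F τ = fun x => q x + ∑ s ∈ F, correction ψ q h s (τ s) x := by
  have hnd : (F.sort (· ≤ ·)).Nodup := Finset.sort_nodup _ _
  unfold qFin
  rw [foldr_step_eq hψ hh τ _ (fun s hs => h1 s ((Finset.mem_sort _).mp hs))]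
  · funext x
    rw [← List.sum_toFinset _ hnd, Finset.sort_toFinset]
  · exact hnd.imp_of_mem fun {a b} ha hb hab =>
      h2 a ((Finset.mem_sort _).mp ha) b ((Finset.mem_sort _).mp hb) hab

theorem contDiff_dent (hψ : SuppAnnulus ψ) (hψs : ContDiff ℝ ∞ ψ) (hq : ContDiff ℝ ∞ q) {t : ℝ}
    (ht : 1 ≤ t) : ContDiff ℝ ∞ (dent ψ q t) :=
  ((contDiff_periodize hψ hψs ht).mul (hq.sub contDiff_const)).neg

theorem contDiff_correction (hψ : SuppAnnulus ψ) (hψs : ContDiff ℝ ∞ ψ) (hq : ContDiff ℝ ∞ q)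
    (hh : SuppAnnulus h) (hhs : ContDiff ℝ ∞ h) {t : ℝ} (ht : 1 ≤ t) (c : ℝ) :
    ContDiff ℝ ∞ (correction ψ q h t c) :=
  (contDiff_dent hψ hψs hq ht).add (contDiff_const.mul (contDiff_periodize hh hhs ht))

theorem dent_periodic (hq : Function.Periodic q 2) (t : ℝ) : Function.Periodic (dent ψ q t) 2 := by
  intro x
  unfold dent
  rw [periodize_periodic ψ t x, hq x]

theorem correction_periodic (hq : Function.Periodic q 2) (t c : ℝ) :
    Function.Periodic (correction ψ q h t c) 2 := by
  intro x
  unfold correction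
  rw [periodize_periodic h t x, dent_periodic hq t x]

theorem iteratedDeriv_correction (hψ : SuppAnnulus ψ) (hψs : ContDiff ℝ ∞ ψ)
    (hq : ContDiff ℝ ∞ q) (hh : SuppAnnulus h) (hhs : ContDiff ℝ ∞ h) {t : ℝ} (ht : 1 ≤ t) (c : ℝ)
    (n : ℕ) (x : ℝ) : iteratedDeriv n (correction ψ q h t c) x =
      iteratedDeriv n (dent ψ q t) x + c * iteratedDeriv n (periodize h t) x := by
  have hn : (n : WithTop ℕ∞) ≤ ∞ := by exact_mod_cast le_top
  have h1 := ((contDiff_dent hψ hψs hq ht).of_le hn).contDiffAt (x := x)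
  have h2 := ((contDiff_periodize hh hhs ht).of_le hn).contDiffAt (x := x)
  unfold correction
  rw [iteratedDeriv_fun_add h1 (contDiffAt_const.mul h2), iteratedDeriv_const_mul c h2]

theorem continuousOn_correction (hψ : SuppAnnulus ψ) (hψs : Continuous ψ) (hq : Continuous q)
    (hh : SuppAnnulus h) (hhs : Continuous h) (c : ℝ) :
    ContinuousOn (fun p : ℝ × ℝ => correction ψ q h p.1 c p.2) (Ici 1 ×ˢ Icc 0 4) := by
  have h1 : Continuous fun p : ℝ × ℝ => q p.2 - q (4 ^ (-p.1)) := by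
    refine (hq.comp continuous_snd).sub (hq.comp ?_)
    exact (Real.continuous_const_rpow (by norm_num)).comp continuous_fst.neg
  exact ((continuousOn_periodize hψ hψs).mul h1.continuousOn).neg.add
    (continuousOn_const.mul (continuousOn_periodize hh hhs))

/-- A series of smooth functions with summable bounds for all derivatives converges in the `C^∞`
topology. -/
theorem contDiff_and_tendstoSmooth {α : Type*} {f : α → ℝ → ℝ} (hq : ContDiff ℝ ∞ q)
    (hf : ∀ a, ContDiff ℝ ∞ (f a)) {v : ℕ → α → ℝ} (hv : ∀ n, Summable (v n))
    (hb : ∀ n a x, |iteratedDeriv n (f a) x| ≤ v n a) :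
    ContDiff ℝ ∞ (fun x => q x + ∑' a, f a x) ∧
      TendstoSmooth (fun (F : Finset α) x => q x + ∑ a ∈ F, f a x)
        (fun x => q x + ∑' a, f a x) atTop := by
  have hb' : ∀ (k : ℕ) (i : α) (x : ℝ), (k : ℕ∞) ≤ ⊤ → ‖iteratedFDeriv ℝ k (f i) x‖ ≤ v k i :=
    fun k i x _ => by
      rw [norm_iteratedFDeriv_eq_norm_iteratedDeriv]; exact hb k i x
  have hsm : ContDiff ℝ ∞ (fun x => ∑' a, f a x) :=
    contDiff_tsum (N := ⊤) hf (fun k _ => hv k) hb'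
  refine ⟨hq.add hsm, fun n => ?_⟩
  have hn : (n : WithTop ℕ∞) ≤ ∞ := by exact_mod_cast le_top
  have htsum : ∀ x, iteratedDeriv n (fun x => ∑' a, f a x) x = ∑' a, iteratedDeriv n (f a) x := by
    intro x
    have h1 := congrFun (iteratedFDeriv_tsum (N := ⊤) hf (fun k _ => hv k) hb' (k := n) le_top) x
    have h2 : Summable fun a => iteratedFDeriv ℝ n (f a) x :=
      Summable.of_norm_bounded (hv n) fun a => hb' n a x le_top
    rw [iteratedDeriv_eq_iteratedFDeriv, h1]
    -- Evaluation at `(1, …, 1)` is continuous and linear, so it passes through the sum and turns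
    -- multilinear derivatives into ordinary ones.
    have h3 := (ContinuousMultilinearMap.apply ℝ (fun _ : Fin n => ℝ) ℝ (fun _ => 1)).map_tsum h2
    simp only [ContinuousMultilinearMap.apply_apply] at h3
    rw [h3]
    rfl
  have hunif := tendstoUniformly_tsum (hv n) (f := fun a x => iteratedDeriv n (f a) x)
    fun a x => hb n a x
  have e1 : iteratedDeriv n (fun x => q x + ∑' a, f a x) =
      fun x => iteratedDeriv n q x + ∑' a, iteratedDeriv n (f a) x := by
    funext x
    rw [iteratedDeriv_fun_add (hq.of_le hn).contDiffAt (hsm.of_le hn).contDiffAt, htsum]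
  have e2 : (fun F : Finset α => iteratedDeriv n (fun x => q x + ∑ a ∈ F, f a x)) =
      fun F x => iteratedDeriv n q x + ∑ a ∈ F, iteratedDeriv n (f a) x := by
    funext F x
    have hF : ContDiff ℝ ∞ fun x => ∑ a ∈ F, f a x := ContDiff.sum fun a _ => hf a
    rw [iteratedDeriv_fun_add (hq.of_le hn).contDiffAt (hF.of_le hn).contDiffAt,
      iteratedDeriv_fun_sum fun a _ => ((hf a).of_le hn).contDiffAt]
  rw [e1, e2]
  refine TendstoUniformly.tendstoLocallyUniformly ?_
  rw [Metric.tendstoUniformly_iff] at hunif ⊢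
  intro ε hε
  filter_upwards [hunif ε hε] with F hF x
  rw [dist_add_left]
  exact hF x

/-! ### Choice of the parameters -/

theorem IsCutoff.suppAnnulus (hψ : IsCutoff ψ) : SuppAnnulus ψ := by
  intro y hy
  have hm : y ∈ tsupport ψ := by
    by_contra hn
    exact hy (image_eq_zero_of_notMem_tsupport hn)
  rcases hψ.supp hm with ⟨h1, h2⟩ | ⟨h1, h2⟩
  · rw [abs_of_neg (by linarith)]; constructor <;> linarith
  · rw [abs_of_pos (by linarith)]; constructor <;> linarith

theorem IsOscillating.mem_of_ne_zero {a : ℝ} (hh : IsOscillating h a) {y : ℝ} (hy : h y ≠ 0) :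
    y ∈ Ioo (-3 / 4 : ℝ) (-1 / 2) ∪ Ioo (1 / 2) (3 / 4) := by
  refine hh.supp ?_
  by_contra hn
  exact hy (image_eq_zero_of_notMem_tsupport hn)

theorem IsOscillating.suppAnnulus {a : ℝ} (hh : IsOscillating h a) : SuppAnnulus h := by
  intro y hy
  rcases hh.mem_of_ne_zero hy with ⟨h1, h2⟩ | ⟨h1, h2⟩
  · rw [abs_of_neg (by linarith)]; constructor <;> linarith
  · rw [abs_of_pos (by linarith)]; constructor <;> linarith

theorem IsOscillating.cutoff_eq_one {a : ℝ} (hh : IsOscillating h a) (hψ : IsCutoff ψ) {y : ℝ}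
    (hy : h y ≠ 0) : ψ y = 1 := by
  refine hψ.eq_one y ?_
  rcases hh.mem_of_ne_zero hy with h1 | h1
  · exact Or.inl (Ioo_subset_Icc_self h1)
  · exact Or.inr (Ioo_subset_Icc_self h1)

theorem IsOscillating.exists_bound {a : ℝ} (hh : IsOscillating h a) : ∃ M, ∀ y, |h y| ≤ M := by
  obtain ⟨C, hC⟩ := isCompact_Icc.exists_bound_of_continuousOn (s := Icc (-1 : ℝ) 1)
    hh.smooth.continuous.continuousOn
  refine ⟨C, fun y => ?_⟩
  by_cases hy : h y = 0
  · rw [hy, abs_zero]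
    exact (norm_nonneg _).trans (hC 0 (by norm_num))
  · exact hC y (abs_le.mp (hh.suppAnnulus y hy).2.le)

/-- Midpoints of consecutive sign intervals tend to `a`, with `h` positive at even and negative at
odd indices; continuity leaves only the value zero. -/
theorem IsOscillating.eq_zero {a : ℝ} (hh : IsOscillating h a) : h a = 0 := by
  obtain ⟨x, hx, -, hlim, hsign, -⟩ := hh.oscillates
  set y := fun i => (x (i + 1) + x i) / 2 with hy
  have hylim : Tendsto y atTop (𝓝 a) := by
    have := ((hlim.comp (tendsto_add_atTop_nat 1)).add hlim).div_const 2
    simpa using this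
  have hhy : ∀ i, (-1) ^ (i + 1) * h (y i) < 0 := fun i => by
    have := hx (Nat.lt_succ_self i)
    exact hsign i _ ⟨by simp only [hy]; linarith, by simp only [hy]; linarith⟩
  have hcont : ∀ φ : ℕ → ℕ, Tendsto φ atTop atTop →
      Tendsto (fun i => h (y (φ i))) atTop (𝓝 (h a)) := fun φ hφ =>
    (hh.smooth.continuous.tendsto a).comp (hylim.comp hφ)
  have hdouble : Tendsto (fun i : ℕ => 2 * i) atTop atTop :=
    tendsto_atTop_mono (fun i => by simp only [id]; omega) tendsto_id
  have hodd : Tendsto (fun i : ℕ => 2 * i + 1) atTop atTop :=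
    tendsto_atTop_mono (fun i => by simp only [id]; omega) tendsto_id
  refine le_antisymm ?_ ?_
  · refine le_of_tendsto' (hcont _ hodd) fun i => ?_
    have := hhy (2 * i + 1)
    rw [show 2 * i + 1 + 1 = 2 * (i + 1) by ring, pow_mul] at this
    simp at this
    exact this.le
  · refine ge_of_tendsto' (hcont _ hdouble) fun i => ?_
    have := hhy (2 * i)
    rw [pow_succ, pow_mul] at this
    simp at this
    exact this.le

theorem IsBase.strictAnti (hq : IsBase ψ q) {x y : ℝ} (hx : 0 ≤ x) (hxy : x < y) (hy : y ≤ 1) :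
    q y < q x :=
  hq.decreasing ⟨hx, hxy.le.trans hy⟩ ⟨hx.trans hxy.le, hy⟩ hxy

theorem IsBase.anti (hq : IsBase ψ q) {x y : ℝ} (hx : 0 ≤ x) (hxy : x ≤ y) (hy : y ≤ 1) :
    q y ≤ q x :=
  hq.decreasing.antitoneOn ⟨hx, hxy.trans hy⟩ ⟨hx.trans hxy, hy⟩ hxy

theorem IsBase.abs_eq (hq : IsBase ψ q) (x : ℝ) : q |x| = q x := by
  rcases abs_choice x with h | h <;> rw [h]
  exact hq.even x

theorem IsBase.rpow_neg_lt (hq : IsBase ψ q) {s t : ℝ} (hs : 0 ≤ s) (hst : s < t) :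
    q (4 ^ (-s)) < q (4 ^ (-t)) :=
  hq.strictAnti (four_rpow_pos _).le
    (Real.rpow_lt_rpow_of_exponent_lt (by norm_num) (by linarith)) (four_rpow_neg_mem hs).2

theorem IsBase.rpow_neg_le (hq : IsBase ψ q) {s t : ℝ} (hs : 0 ≤ s) (hst : s ≤ t) :
    q (4 ^ (-s)) ≤ q (4 ^ (-t)) :=
  hst.eq_or_lt.elim (fun h => by rw [h]) fun h => (hq.rpow_neg_lt hs h).le

theorem IsBase.rpow_neg_lt_zero (hq : IsBase ψ q) {t : ℝ} (ht : 0 ≤ t) : q (4 ^ (-t)) < q 0 :=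
  hq.strictAnti le_rfl (four_rpow_pos _) (four_rpow_neg_mem ht).2

/-- The conditions on the range `[a,b]` of the scale, the amplitude `c` and the frequency `m` at
the `i`-th place, where `M` bounds `|h|`. -/
structure Admissible (ψ q h : ℝ → ℝ) (M : ℝ) (i : ℕ) (a b c : ℝ) (m : ℕ) : Prop where
  two_le : 2 ≤ a
  le : a ≤ b
  m_pos : 0 < m
  c_ne : c ≠ 0
  flat : ∀ t, a ≤ t → ∀ n ≤ i, ∀ x, |iteratedDeriv n (dent ψ q t) x| ≤ (1 / 2) ^ i
  small : ∀ t ∈ Icc a b, ∀ n ≤ i, ∀ x, |c| * |iteratedDeriv n (periodize h t) x| ≤ (1 / 2) ^ i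
  -- Keeps the perturbed plateau below the peak value `q 0` for all `t ≤ b`.
  upper : |c| * M ≤ q 0 - q (4 ^ (-b))
  -- Costs the plateau at most half a unit of scale: for `t ≥ a` it stays above `q (4^(-(a -
  -- 1/2)))`, hence positive.
  lower : |c| * M ≤ q (4 ^ (-a)) - q (4 ^ (-(a - 1 / 2)))
  -- Gives the sign of the equation at `t = a`: the quotient is the Sturm bound on the eigenvalue
  -- from a neighbourhood of `2` of radius `4^(-(a + 1))`.
  m_large : ((m : ℝ) ^ 2 + (Real.pi / (2 * 4 ^ (-(a + 1)))) ^ 2) / q (4 ^ (-(a + 1 / 2))) *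
    q (4 ^ (-a)) ≤ (m : ℝ) ^ 2
  -- Gives the sign at `t = b`, against the eigenvalue bound from `Q ≤ q 0`.
  b_large : (m : ℝ) ^ 2 * q 0 ≤ ((m : ℝ) ^ 2 + 1 / 64) * q (4 ^ (-b))

theorem eventually_dent_small (hψ : IsCutoff ψ) (hq : IsBase ψ q) (n : ℕ) {ε : ℝ} (hε : 0 < ε) :
    ∀ᶠ t : ℝ in atTop, ∀ x, |iteratedDeriv n (dent ψ q t) x| ≤ ε := by
  have hn : (n : WithTop ℕ∞) ≤ ∞ := by exact_mod_cast le_top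
  have h1 := (tendstoLocallyUniformlyOn_univ.mpr (hq.flat n)).mono (subset_univ (Icc (-1 : ℝ) 1))
  rw [tendstoLocallyUniformlyOn_iff_tendstoUniformlyOn_of_compact isCompact_Icc,
    Metric.tendstoUniformlyOn_iff] at h1
  filter_upwards [h1 ε hε, eventually_ge_atTop 1] with t ht ht1 x
  obtain ⟨y, hy, k, rfl⟩ := exists_eq_add_int_mul_two x
  rw [(iteratedDeriv_periodic (dent_periodic hq.periodic t) n).int_mul k y]
  have h2 : pinch ψ t q = fun x => q x + dent ψ q t x := by
    funext x; unfold pinch phi dent; ring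
  have h3 := ht y hy
  rw [h2, iteratedDeriv_fun_add (hq.smooth.of_le hn).contDiffAt
    ((contDiff_dent hψ.suppAnnulus hψ.smooth hq.smooth ht1).of_le hn).contDiffAt,
    dist_comm, Real.dist_eq, add_sub_cancel_left] at h3
  exact h3.le

theorem exists_admissible {x₀ : ℝ} (hψ : IsCutoff ψ) (hq : IsBase ψ q) (hh : IsOscillating h x₀)
    (M B : ℝ) (i : ℕ) : ∃ (a b c : ℝ) (m : ℕ), B + 1 ≤ a ∧ Admissible ψ q h M i a b c m := by
  have hpow : (0 : ℝ) < (1 / 2) ^ i := by positivity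
  obtain ⟨T, hT⟩ := eventually_atTop.mp ((Finset.range (i + 1)).eventually_all.mpr fun n _ =>
    eventually_dent_small hψ hq n hpow)
  set a := max (max 2 (B + 1)) T with ha
  have ha2 : 2 ≤ a := (le_max_left _ _).trans (le_max_left _ _)
  have haB : B + 1 ≤ a := (le_max_right _ _).trans (le_max_left _ _)
  have hflat : ∀ t, a ≤ t → ∀ n ≤ i, ∀ x, |iteratedDeriv n (dent ψ q t) x| ≤ (1 / 2) ^ i :=
    fun t ht n hn x => hT t ((le_max_right _ _).trans ht) n (by simp; omega) x
  set κ := (Real.pi / (2 * 4 ^ (-(a + 1)))) ^ 2 with hκ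
  set q₀ := q (4 ^ (-a)) with hq₀
  set q₁ := q (4 ^ (-(a + 1 / 2))) with hq₁
  have hlt : q₀ < q₁ := hq.rpow_neg_lt (by linarith) (by linarith)
  have hq₁pos : 0 < q₁ := hq.pos _
  obtain ⟨m, hm⟩ := exists_nat_gt (max 1 (κ * q₀ / (q₁ - q₀)))
  have hm1 : (1 : ℝ) < m := (le_max_left _ _).trans_lt hm
  -- Since `m ≤ m^2`, this yields `(m^2 + κ) * q₀ ≤ m^2 * q₁`: the fixed localization cost `κ` is
  -- absorbed by the strict gap between `q₀` and `q₁`.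
  have hm2 : κ * q₀ < m * (q₁ - q₀) :=
    (div_lt_iff₀ (by linarith)).mp ((le_max_right _ _).trans_lt hm)
  have hmm : (m : ℝ) ≤ (m : ℝ) ^ 2 := by nlinarith
  have hmlarge : ((m : ℝ) ^ 2 + κ) / q₁ * q₀ ≤ (m : ℝ) ^ 2 := by
    rw [div_mul_eq_mul_div, div_le_iff₀ hq₁pos]
    nlinarith [mul_le_mul_of_nonneg_right hmm (sub_pos.mpr hlt).le]
  have hblim : Tendsto (fun b : ℝ => ((m : ℝ) ^ 2 + 1 / 64) * q (4 ^ (-b))) atTop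
      (𝓝 (((m : ℝ) ^ 2 + 1 / 64) * q 0)) := by
    refine ((hq.smooth.continuous.tendsto 0).comp ?_).const_mul _
    exact (tendsto_rpow_atBot_of_base_gt_one 4 (by norm_num)).comp tendsto_neg_atTop_atBot
  obtain ⟨b, hbl, hab⟩ := ((hblim.eventually_const_lt
    (show (m : ℝ) ^ 2 * q 0 < _ by nlinarith [hq.pos 0])).and (eventually_ge_atTop a)).exists
  -- The amplitude comes last: it meets finitely many smallness conditions, whose bounds depend only
  -- on `a`, `b` and the index.
  have hsm : ∀ K ε : ℝ, 0 < ε → ∀ᶠ c : ℝ in 𝓝[>] 0, |c| * K ≤ ε := by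
    intro K ε hε
    have hc : Continuous fun c : ℝ => |c| * K := by fun_prop
    have := (hc.tendsto 0).mono_left (nhdsWithin_le_nhds (s := Ioi 0))
    simp only [abs_zero, zero_mul] at this
    exact (this.eventually_lt_const hε).mono fun c hc => hc.le
  choose C hC using exists_bound_iteratedDeriv_periodize hh.suppAnnulus hh.smooth b
  have hev : ∀ᶠ c : ℝ in 𝓝[>] 0, ∀ n ∈ Finset.range (i + 1), |c| * C n ≤ (1 / 2) ^ i :=
    (Finset.range (i + 1)).eventually_all.mpr fun n _ => hsm (C n) _ hpow
  obtain ⟨c, ⟨⟨⟨hc1, hc2⟩, hc3⟩, hc4⟩⟩ := (((hev.and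
    (hsm M _ (sub_pos.mpr (hq.rpow_neg_lt_zero (t := b) (by linarith))))).and
    (hsm M _ (sub_pos.mpr (hq.rpow_neg_lt (s := a - 1 / 2) (t := a) (by linarith)
      (by linarith))))).and self_mem_nhdsWithin).exists
  refine ⟨a, b, c, m, haB, ha2, hab, by exact_mod_cast one_pos.trans hm1, ne_of_gt hc4, hflat,
    fun t ht n hn x => ?_, hc2, hc3, hmlarge, hbl.le⟩
  refine le_trans ?_ (hc1 n (by simp; omega))
  exact mul_le_mul_of_nonneg_left (hC n t ⟨by linarith [ht.1], ht.2⟩ x) (abs_nonneg c)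

/-- A sequence of admissible parameters with separated ranges. -/
structure AdmissibleSeq (ψ q h : ℝ → ℝ) (M : ℝ) (a b c : ℕ → ℝ) (m : ℕ → ℕ) : Prop where
  adm : ∀ i, Admissible ψ q h M i (a i) (b i) (c i) (m i)
  sep : ∀ i, b i + 1 ≤ a (i + 1)

theorem exists_admissibleSeq {x₀ : ℝ} (hψ : IsCutoff ψ) (hq : IsBase ψ q)
    (hh : IsOscillating h x₀) (M : ℝ) :
    ∃ (a b c : ℕ → ℝ) (m : ℕ → ℕ), AdmissibleSeq ψ q h M a b c m := by
  choose A B C m hB hadm using fun (B : ℝ) (i : ℕ) => exists_admissible hψ hq hh M B i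
  -- `β (i + 1)` is the right end of the `i`-th range and serves as the lower barrier for the next
  -- choice.
  set β : ℕ → ℝ := fun i => Nat.rec 0 (fun i y => B y i) i with hβ
  exact ⟨fun i => A (β i) i, fun i => B (β i) i, fun i => C (β i) i, fun i => m (β i) i,
    fun i => hadm _ _, fun i => hB (β (i + 1)) (i + 1)⟩

namespace AdmissibleSeq

variable {M : ℝ} {a b c : ℕ → ℝ} {m : ℕ → ℕ}

theorem sep_of_lt (H : AdmissibleSeq ψ q h M a b c m) {i j : ℕ} (hij : i < j) :
    b i + 1 ≤ a j := by
  induction j, hij using Nat.le_induction with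
  | base => exact H.sep i
  | succ j _ ih => linarith [H.sep j, (H.adm j).le]

variable {t : ℕ → ℝ}

theorem scale_sep (H : AdmissibleSeq ψ q h M a b c m) (ht : ∀ i, t i ∈ Icc (a i) (b i)) {i j : ℕ}
    (hij : i < j) : t i + 1 ≤ t j := by
  linarith [H.sep_of_lt hij, (ht i).2, (ht j).1]

theorem scale_abs_sep (H : AdmissibleSeq ψ q h M a b c m) (ht : ∀ i, t i ∈ Icc (a i) (b i))
    {i j : ℕ} (hij : i ≠ j) : 1 ≤ |t i - t j| := by
  rcases lt_or_gt_of_ne hij with h | h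
  · rw [abs_sub_comm]
    exact le_trans (by linarith [H.scale_sep ht h]) (le_abs_self _)
  · exact le_trans (by linarith [H.scale_sep ht h]) (le_abs_self _)

theorem two_le_scale (H : AdmissibleSeq ψ q h M a b c m) (ht : ∀ i, t i ∈ Icc (a i) (b i))
    (i : ℕ) : 2 ≤ t i := (H.adm i).two_le.trans (ht i).1

end AdmissibleSeq

/-! ### The limit function: bounds, plateau values and eigenvalue signs. -/

/-- The limit function with scales `t` and amplitudes `c`. -/
def limitFun (ψ q h : ℝ → ℝ) (t c : ℕ → ℝ) (x : ℝ) : ℝ :=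
  q x + ∑' i, correction ψ q h (t i) (c i) x

theorem limitFun_periodic (hq : Function.Periodic q 2) (t c : ℕ → ℝ) :
    Function.Periodic (limitFun ψ q h t c) 2 := by
  intro x
  unfold limitFun
  rw [hq x]
  congr 2
  funext i
  exact correction_periodic hq _ _ x

namespace AdmissibleSeq

variable {M x₀ : ℝ} {a b c : ℕ → ℝ} {m : ℕ → ℕ} {t : ℕ → ℝ}

theorem abs_iteratedDeriv_correction_le (H : AdmissibleSeq ψ q h M a b c m) (hψ : IsCutoff ψ)
    (hq : IsBase ψ q) (hh : IsOscillating h x₀) {i n : ℕ} (hn : n ≤ i) {s : ℝ}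
    (hs : s ∈ Icc (a i) (b i)) (x : ℝ) :
    |iteratedDeriv n (correction ψ q h s (c i)) x| ≤ 2 * (1 / 2) ^ i := by
  rw [iteratedDeriv_correction hψ.suppAnnulus hψ.smooth hq.smooth hh.suppAnnulus hh.smooth
    (by linarith [(H.adm i).two_le, hs.1])]
  refine (abs_add_le _ _).trans ?_
  rw [abs_mul]
  linarith [(H.adm i).flat s hs.1 n hn x, (H.adm i).small s hs n hn x]

/-- The geometric bound needs `n ≤ i`. The finitely many earlier terms use a crude bound, available
because each correction is smooth and periodic. -/
theorem exists_summable_bound (H : AdmissibleSeq ψ q h M a b c m) (hψ : IsCutoff ψ)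
    (hq : IsBase ψ q) (hh : IsOscillating h x₀) (ht : ∀ i, t i ∈ Icc (a i) (b i)) (n : ℕ) :
    ∃ v : ℕ → ℝ, Summable v ∧
      ∀ i x, |iteratedDeriv n (correction ψ q h (t i) (c i)) x| ≤ v i := by
  choose C hC using fun i => exists_bound_iteratedDeriv
    (correction_periodic (ψ := ψ) (h := h) hq.periodic (t i) (c i))
    (contDiff_correction hψ.suppAnnulus hψ.smooth hq.smooth hh.suppAnnulus hh.smooth
      (by linarith [H.two_le_scale ht i]) (c i)) n
  refine ⟨fun i => 2 * (1 / 2) ^ i + if i ∈ Finset.range n then C i else 0,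
    (summable_geometric_two.mul_left 2).add (summable_of_ne_finset_zero (s := Finset.range n)
      fun i hi => if_neg hi), fun i x => ?_⟩
  by_cases hi : i < n
  · have h1 : (0 : ℝ) < 2 * (1 / 2) ^ i := by positivity
    simp only [Finset.mem_range, hi, if_true]
    linarith [hC i x]
  · simp only [Finset.mem_range, hi, if_false, add_zero]
    exact H.abs_iteratedDeriv_correction_le hψ hq hh (not_lt.mp hi) (ht i) x

/-- At every point of `[-1,1]` at most one correction term is active. -/
theorem limitFun_eq (H : AdmissibleSeq ψ q h M a b c m) (hψ : IsCutoff ψ)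
    (hh : IsOscillating h x₀) (ht : ∀ i, t i ∈ Icc (a i) (b i)) {y : ℝ} (hy : |y| ≤ 1) :
    limitFun ψ q h t c y = q y ∨ ∃ i, 1 / 4 < 4 ^ t i * |y| ∧ 4 ^ t i * |y| < 1 ∧
      limitFun ψ q h t c y = q y - ψ (4 ^ t i * y) * (q y - q (4 ^ (-t i))) +
        c i * h (4 ^ t i * y) := by
  have hy' : |y| ≤ 7 / 4 := by linarith
  have h1 : ∀ i, 1 ≤ t i := fun i => by linarith [H.two_le_scale ht i]
  by_cases hex : ∃ i, periodize ψ (t i) y ≠ 0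
  · obtain ⟨i, hi⟩ := hex
    have h2 : limitFun ψ q h t c y = q y + correction ψ q h (t i) (c i) y := by
      unfold limitFun
      rw [tsum_eq_single i]
      intro j hj
      have hd := H.scale_abs_sep ht hj.symm
      simp [correction, dent, periodize_eq_zero_of_ne_zero hψ.suppAnnulus hψ.suppAnnulus
        (h1 i) (h1 j) hd hi, periodize_eq_zero_of_ne_zero hψ.suppAnnulus hh.suppAnnulus
        (h1 i) (h1 j) hd hi]
    rw [periodize_eq hψ.suppAnnulus (h1 i) hy'] at hi
    have h3 := hψ.suppAnnulus _ hi
    rw [abs_mul, abs_of_pos (four_rpow_pos _)] at h3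
    refine Or.inr ⟨i, h3.1, h3.2, ?_⟩
    rw [h2, correction, dent, periodize_eq hψ.suppAnnulus (h1 i) hy',
      periodize_eq hh.suppAnnulus (h1 i) hy']
    ring
  · push Not at hex
    left
    have h0 : ∀ i, correction ψ q h (t i) (c i) y = 0 := by
      intro i
      have hpsi := hex i
      rw [periodize_eq hψ.suppAnnulus (h1 i) hy'] at hpsi
      have hz : h (4 ^ t i * y) = 0 := by
        by_contra hne
        rw [hh.cutoff_eq_one hψ hne] at hpsi
        exact one_ne_zero hpsi
      simp [correction, dent, hex i, periodize_eq hh.suppAnnulus (h1 i) hy', hz]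
    unfold limitFun
    simp [h0]

/-- The values of the limit function on the support of an active correction term. -/
theorem bounds_of_active (hψ : IsCutoff ψ) (hq : IsBase ψ q) (hh : IsOscillating h x₀)
    (hM : ∀ y, |h y| ≤ M) {s d y : ℝ} (hs : 0 ≤ s) (hy : 4 ^ s * |y| < 1) :
    q (4 ^ (-s)) - |d| * M ≤ q y - ψ (4 ^ s * y) * (q y - q (4 ^ (-s))) + d * h (4 ^ s * y) ∧
    (q y - ψ (4 ^ s * y) * (q y - q (4 ^ (-s))) + d * h (4 ^ s * y) ≤ q y ∨
      q y - ψ (4 ^ s * y) * (q y - q (4 ^ (-s))) + d * h (4 ^ s * y) ≤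
        q (4 ^ (-s)) + |d| * M) := by
  have hyle : |y| ≤ 4 ^ (-s) := by
    have h1 := four_rpow_mul_neg s
    have h2 := four_rpow_pos s
    nlinarith
  have hqy : q (4 ^ (-s)) ≤ q y := by
    rw [← hq.abs_eq y]
    exact hq.anti (abs_nonneg y) hyle (four_rpow_neg_mem hs).2
  -- Either `h` vanishes and the value is a convex combination of `q y` and `q (4^(-s))`, or the
  -- cutoff is `1` and the value is the plateau height plus a small oscillation.
  by_cases hz : h (4 ^ s * y) = 0
  · have h1 := hψ.mem_Icc (4 ^ s * y)
    have h2 : 0 ≤ |d| * M := mul_nonneg (abs_nonneg d) ((abs_nonneg _).trans (hM 0))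
    rw [hz]
    exact ⟨by nlinarith [h1.2], Or.inl (by nlinarith [h1.1])⟩
  · rw [hh.cutoff_eq_one hψ hz]
    have h1 : |d * h (4 ^ s * y)| ≤ |d| * M := by
      rw [abs_mul]; exact mul_le_mul_of_nonneg_left (hM _) (abs_nonneg d)
    have h2 := abs_le.mp h1
    exact ⟨by linarith, Or.inr (by linarith)⟩

theorem limitFun_pos_le (H : AdmissibleSeq ψ q h M a b c m) (hψ : IsCutoff ψ) (hq : IsBase ψ q)
    (hh : IsOscillating h x₀) (hM : ∀ y, |h y| ≤ M) (ht : ∀ i, t i ∈ Icc (a i) (b i)) (x : ℝ) :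
    0 < limitFun ψ q h t c x ∧ limitFun ψ q h t c x ≤ q 0 := by
  obtain ⟨y, hy, k, rfl⟩ := exists_eq_add_int_mul_two x
  rw [(limitFun_periodic hq.periodic t c).int_mul k y]
  have hy' : |y| ≤ 1 := abs_le.mpr hy
  have hqy : q y ≤ q 0 := by
    rw [← hq.abs_eq y]
    exact hq.anti le_rfl (abs_nonneg y) hy'
  rcases H.limitFun_eq hψ hh ht hy' with he | ⟨i, -, hi, he⟩
  · rw [he]; exact ⟨hq.pos y, hqy⟩
  · have ht0 := H.two_le_scale ht i
    obtain ⟨h1, h2⟩ := bounds_of_active hψ hq hh hM (d := c i) (by linarith : 0 ≤ t i) hi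
    rw [← he] at h1 h2
    constructor
    · have h3 := hq.rpow_neg_le (by linarith [(H.adm i).two_le]) (ht i).1
      linarith [(H.adm i).lower, hq.pos (4 ^ (-(a i - 1 / 2)))]
    · rcases h2 with h2 | h2
      · exact h2.trans hqy
      · have h3 := hq.rpow_neg_le (by linarith) (ht i).2
        linarith [(H.adm i).upper]

/-- By periodicity the point lies within `4^(-(a i + 1))` of the peak at `0`, inside the annuli of
all scales up to `a i`. Finer plateaus are high enough by `lower`, because `a j - 1/2 ≥ a i + 1/2`
for `j > i`. -/
theorem le_limitFun (H : AdmissibleSeq ψ q h M a b c m) (hψ : IsCutoff ψ) (hq : IsBase ψ q)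
    (hh : IsOscillating h x₀) (hM : ∀ y, |h y| ≤ M) (ht : ∀ i, t i ∈ Icc (a i) (b i)) {i : ℕ}
    (hi : t i = a i) {x : ℝ} (hx : x ∈ Icc (2 - 4 ^ (-(a i + 1))) (2 + (4 : ℝ) ^ (-(a i + 1)))) :
    q (4 ^ (-(a i + 1 / 2))) ≤ limitFun ψ q h t c x := by
  have ha := (H.adm i).two_le
  have hδ := four_rpow_neg_mem (t := a i + 1) (by linarith)
  set y := x - 2 with hy
  have hyd : |y| ≤ 4 ^ (-(a i + 1)) := abs_le.mpr ⟨by linarith [hx.1], by linarith [hx.2]⟩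
  have hy1 : |y| ≤ 1 := hyd.trans hδ.2
  have hxy : limitFun ψ q h t c x = limitFun ψ q h t c y :=
    ((limitFun_periodic hq.periodic t c).sub_eq x).symm
  rw [hxy]
  rcases H.limitFun_eq hψ hh ht hy1 with he | ⟨j, hj1, hj2, he⟩
  · rw [he, ← hq.abs_eq y]
    have h1 : (4 : ℝ) ^ (-(a i + 1)) ≤ 4 ^ (-(a i + 1 / 2)) :=
      Real.rpow_le_rpow_of_exponent_le (by norm_num) (by linarith)
    exact hq.anti (abs_nonneg y) (hyd.trans h1) (four_rpow_neg_mem (by linarith)).2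
  · have ht0 := H.two_le_scale ht j
    obtain ⟨h1, -⟩ := bounds_of_active hψ hq hh hM (d := c j) (by linarith : 0 ≤ t j) hj2
    rw [← he] at h1
    have hlt : t i < t j := by
      by_contra! hle
      have h2 : (4 : ℝ) ^ t j * |y| ≤ 4 ^ (-1 : ℝ) := by
        calc (4 : ℝ) ^ t j * |y| ≤ 4 ^ a i * 4 ^ (-(a i + 1)) := by
              have h3 : (4 : ℝ) ^ t j ≤ 4 ^ a i :=
                Real.rpow_le_rpow_of_exponent_le (by norm_num) (hi ▸ hle)
              have := four_rpow_pos (a i)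
              gcongr
          _ = 4 ^ (-1 : ℝ) := by rw [← Real.rpow_add (by norm_num)]; congr 1; ring
      rw [Real.rpow_neg_one] at h2
      linarith
    have hij : i < j := by
      by_contra! hle
      rcases hle.eq_or_lt with h | h
      · rw [h] at hlt; exact lt_irrefl _ hlt
      · linarith [H.scale_sep ht h]
    have h2 := H.sep_of_lt hij
    have h3 := hq.rpow_neg_le (s := a i + 1 / 2) (t := a j - 1 / 2) (by linarith)
      (by linarith [(H.adm i).le])
    have h4 := hq.rpow_neg_le (by linarith [(H.adm j).two_le]) (ht j).1
    linarith [(H.adm j).lower]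

/-- Here the cutoff is `1`, `h` vanishes and no other scale is active. This factor of the equation
thus depends on `t i` alone. -/
theorem limitFun_at_plateau (H : AdmissibleSeq ψ q h M a b c m) (hψ : IsCutoff ψ)
    (hh : IsOscillating h x₀) (ht : ∀ i, t i ∈ Icc (a i) (b i)) (i : ℕ) :
    limitFun ψ q h t c (4 ^ (-t i) * x₀) = q (4 ^ (-t i)) := by
  have h1 : ∀ i, 1 ≤ t i := fun i => by linarith [H.two_le_scale ht i]
  have hm := four_rpow_neg_mem (t := t i) (by linarith [h1 i])
  have hx := hh.mem
  have hy : |(4 : ℝ) ^ (-t i) * x₀| ≤ 7 / 4 := by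
    rw [abs_of_nonneg (mul_nonneg hm.1 (by linarith [hx.1]))]
    nlinarith [hm.1, hm.2, hx.1, hx.2]
  have hsc : (4 : ℝ) ^ t i * (4 ^ (-t i) * x₀) = x₀ := by
    rw [← mul_assoc, four_rpow_mul_neg, one_mul]
  have hp : periodize ψ (t i) (4 ^ (-t i) * x₀) = 1 := by
    rw [periodize_eq hψ.suppAnnulus (h1 i) hy, hsc]
    exact hψ.eq_one _ (Or.inr (Ioo_subset_Icc_self hx))
  unfold limitFun
  rw [tsum_eq_single i]
  · rw [correction, dent, hp, periodize_eq hh.suppAnnulus (h1 i) hy, hsc, hh.eq_zero]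
    ring
  · intro j hj
    have hd := H.scale_abs_sep ht hj.symm
    have hne : periodize ψ (t i) (4 ^ (-t i) * x₀) ≠ 0 := by rw [hp]; exact one_ne_zero
    simp [correction, dent, periodize_eq_zero_of_ne_zero hψ.suppAnnulus hψ.suppAnnulus
      (h1 i) (h1 j) hd hne, periodize_eq_zero_of_ne_zero hψ.suppAnnulus hh.suppAnnulus
      (h1 i) (h1 j) hd hne]

theorem contDiff_correction' (H : AdmissibleSeq ψ q h M a b c m) (hψ : IsCutoff ψ)
    (hq : IsBase ψ q) (hh : IsOscillating h x₀) (ht : ∀ i, t i ∈ Icc (a i) (b i)) (i : ℕ) :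
    ContDiff ℝ ∞ (correction ψ q h (t i) (c i)) :=
  contDiff_correction hψ.suppAnnulus hψ.smooth hq.smooth hh.suppAnnulus hh.smooth
    (by linarith [H.two_le_scale ht i]) (c i)

theorem contDiff_limitFun (H : AdmissibleSeq ψ q h M a b c m) (hψ : IsCutoff ψ)
    (hq : IsBase ψ q) (hh : IsOscillating h x₀) (ht : ∀ i, t i ∈ Icc (a i) (b i)) :
    ContDiff ℝ ∞ (limitFun ψ q h t c) := by
  choose v hv hb using H.exists_summable_bound hψ hq hh ht
  exact (contDiff_and_tendstoSmooth hq.smooth (H.contDiff_correction' hψ hq hh ht) hv hb).1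

/-- Face `t i = a i` of the cube: a wide neighbourhood of the peak rises above the plateau and keeps
the eigenvalue small. -/
theorem eigenvalue_upper (H : AdmissibleSeq ψ q h M a b c m) (hψ : IsCutoff ψ)
    (hq : IsBase ψ q) (hh : IsOscillating h x₀) (hM : ∀ y, |h y| ≤ M)
    (ht : ∀ i, t i ∈ Icc (a i) (b i)) {i : ℕ} (hi : t i = a i) :
    firstEigenvalue (limitFun ψ q h t c) (m i) * q (4 ^ (-t i)) - (m i : ℝ) ^ 2 ≤ 0 := by
  have ha := (H.adm i).two_le
  have h1 := firstEigenvalue_le_of_ge (m := m i) (H.contDiff_limitFun hψ hq hh ht).continuous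
    (fun x _ => (H.limitFun_pos_le hψ hq hh hM ht x).1) (hq.pos _) (four_rpow_pos _)
    (by linarith [(four_rpow_neg_mem (t := a i + 1) (by linarith)).2])
    (fun x hx => H.le_limitFun hψ hq hh hM ht hi hx)
  have h2 := mul_le_mul_of_nonneg_right h1 (hq.pos (4 ^ (-a i))).le
  rw [hi]
  linarith [(H.adm i).m_large]

/-- Face `t i = b i`: the plateau is almost as high as the peak, while confinement to length `4`
still contributes `1 / 64`. -/
theorem eigenvalue_lower (H : AdmissibleSeq ψ q h M a b c m) (hψ : IsCutoff ψ)
    (hq : IsBase ψ q) (hh : IsOscillating h x₀) (hM : ∀ y, |h y| ≤ M)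
    (ht : ∀ i, t i ∈ Icc (a i) (b i)) {i : ℕ} (hi : t i = b i) :
    0 ≤ firstEigenvalue (limitFun ψ q h t c) (m i) * q (4 ^ (-t i)) - (m i : ℝ) ^ 2 := by
  have h1 := le_firstEigenvalue_of_le (m := m i) (H.contDiff_limitFun hψ hq hh ht).continuous
    (fun x _ => (H.limitFun_pos_le hψ hq hh hM ht x).1) (hq.pos 0)
    (fun x _ => (H.limitFun_pos_le hψ hq hh hM ht x).2)
  rw [div_le_iff₀ (hq.pos 0)] at h1
  have h2 := (H.adm i).b_large
  rw [hi, sub_nonneg]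
  have hq0 := hq.pos 0
  have hqb := hq.pos (4 ^ (-b i))
  refine le_of_mul_le_mul_right ?_ hq0
  calc (m i : ℝ) ^ 2 * q 0 ≤ ((m i : ℝ) ^ 2 + 1 / 64) * q (4 ^ (-b i)) := h2
    _ ≤ firstEigenvalue (limitFun ψ q h t c) (m i) * q 0 * q (4 ^ (-b i)) := by gcongr
    _ = _ := by ring

/-! ### Solving all equations over the Hilbert cube of scales. -/

/-- The scales of a point of the Hilbert cube. -/
def scale (a b : ℕ → ℝ) (s : ℕ → ℝ) (i : ℕ) : ℝ :=
  a i + (b i - a i) * (projIcc (0 : ℝ) 1 zero_le_one (s i) : ℝ)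

theorem scale_mem (H : AdmissibleSeq ψ q h M a b c m) (s : ℕ → ℝ) (i : ℕ) :
    scale a b s i ∈ Icc (a i) (b i) := by
  have h1 := (projIcc (0 : ℝ) 1 zero_le_one (s i)).2
  have h2 := (H.adm i).le
  unfold scale
  constructor <;> nlinarith [h1.1, h1.2]

theorem continuous_scale (a b : ℕ → ℝ) (i : ℕ) : Continuous fun s => scale a b s i := by
  unfold scale
  exact continuous_const.add (continuous_const.mul
    (continuous_subtype_val.comp (continuous_projIcc.comp (continuous_apply i))))

/-- The Weierstrass test gives joint continuity in the scales and the point; compactness of `[0,4]`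
upgrades it to uniform convergence of the weights, which controls the eigenvalue. -/
theorem continuous_eigenvalue (H : AdmissibleSeq ψ q h M a b c m) (hψ : IsCutoff ψ)
    (hq : IsBase ψ q) (hh : IsOscillating h x₀) (hM : ∀ y, |h y| ≤ M) (k : ℕ) :
    Continuous fun s => firstEigenvalue (limitFun ψ q h (scale a b s) c) k := by
  have hjoint : ContinuousOn (fun p : (ℕ → ℝ) × ℝ => limitFun ψ q h (scale a b p.1) c p.2)
      (univ ×ˢ Icc 0 4) := by
    refine (hq.smooth.continuous.comp continuous_snd).continuousOn.add (continuousOn_tsum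
      (u := fun i => 2 * (1 / 2 : ℝ) ^ i) (fun i => ?_) (summable_geometric_two.mul_left 2)
      fun i p _ => ?_)
    · refine (continuousOn_correction hψ.suppAnnulus hψ.smooth.continuous hq.smooth.continuous
        hh.suppAnnulus hh.smooth.continuous (c i)).comp (f := fun p : (ℕ → ℝ) × ℝ =>
          (scale a b p.1 i, p.2)) ?_ ?_
      · exact (((continuous_scale a b i).comp continuous_fst).prodMk continuous_snd).continuousOn
      · intro p hp
        exact ⟨one_le_two.trans ((H.adm i).two_le.trans (H.scale_mem p.1 i).1), hp.2⟩
    · have := H.abs_iteratedDeriv_correction_le hψ hq hh (Nat.zero_le i) (H.scale_mem p.1 i) p.2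
      rwa [iteratedDeriv_zero] at this
  have hcont := fun s => (H.contDiff_limitFun hψ hq hh (H.scale_mem s)).continuous
  have hpos := fun s x => (H.limitFun_pos_le hψ hq hh hM (H.scale_mem s) x).1
  rw [continuous_iff_continuousAt]
  intro s
  refine tendsto_firstEigenvalue hcont (fun s x _ => hpos s x) (hcont s) (fun x _ => hpos s x) ?_
  rw [Metric.tendstoUniformlyOn_iff]
  intro ε hε
  obtain ⟨v, hv, hvε⟩ := IsCompact.mem_uniformity_of_prod isCompact_Icc
    (f := fun s x => limitFun ψ q h (scale a b s) c x) (s := univ) hjoint (mem_univ s)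
    (Metric.dist_mem_uniformity hε)
  rw [nhdsWithin_univ] at hv
  filter_upwards [hv] with s' hs' x hx
  rw [dist_comm]
  exact hvε s' hs' x hx

/-- Scales which solve all eigenvalue equations simultaneously. -/
theorem exists_scales (H : AdmissibleSeq ψ q h M a b c m) (hψ : IsCutoff ψ)
    (hq : IsBase ψ q) (hh : IsOscillating h x₀) (hM : ∀ y, |h y| ≤ M) :
    ∃ t : ℕ → ℝ, (∀ i, t i ∈ Icc (a i) (b i)) ∧
      ∀ i, firstEigenvalue (limitFun ψ q h t c) (m i) * q (4 ^ (-t i)) - (m i : ℝ) ^ 2 = 0 := by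
  have hcont : ∀ i, Continuous fun s => firstEigenvalue (limitFun ψ q h (scale a b s) c) (m i) *
      q (4 ^ (-scale a b s i)) - (m i : ℝ) ^ 2 := fun i =>
    ((H.continuous_eigenvalue hψ hq hh hM (m i)).mul (hq.smooth.continuous.comp
      ((Real.continuous_const_rpow (by norm_num)).comp (continuous_scale a b i).neg))).sub
      continuous_const
  obtain ⟨s, -, hs⟩ := poincare_miranda _ (fun i => (hcont i).continuousOn)
    (fun i s _ hi => H.eigenvalue_upper hψ hq hh hM (H.scale_mem s) (by simp [scale, hi]))
    (fun i s _ hi => H.eigenvalue_lower hψ hq hh hM (H.scale_mem s) (by simp [scale, hi]))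
  exact ⟨scale a b s, H.scale_mem s, hs⟩

end AdmissibleSeq

/-- On the range of a separated sequence of scales the partial functions `q_{F,τ}` converge to
the limit function in the `C^∞` topology. -/
theorem AdmissibleSeq.tendstoSmooth_qSub {M x₀ : ℝ} {a b c t : ℕ → ℝ} {m : ℕ → ℕ} {τ : ℝ → ℝ}
    (H : AdmissibleSeq ψ q h M a b c m) (hψ : IsCutoff ψ) (hq : IsBase ψ q)
    (hh : IsOscillating h x₀) (ht : ∀ i, t i ∈ Icc (a i) (b i)) (hτ : ∀ i, τ (t i) = c i) :
    TendstoSmooth (qSub ψ q h (range t) τ) (limitFun ψ q h t c) atTop := by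
  have hinj : Function.Injective t := by
    refine StrictMono.injective fun i j hij => ?_
    linarith [H.scale_sep ht hij]
  set e := Equiv.ofInjective t hinj with he
  set f : range t → ℝ → ℝ := fun s => correction ψ q h s (τ s) with hf
  have hfe : ∀ i, f (e i) = correction ψ q h (t i) (c i) := fun i => by
    simp only [hf, he, Equiv.ofInjective_apply, hτ]
  choose v hv hb using H.exists_summable_bound hψ hq hh ht
  have hfs : ∀ s, f s = correction ψ q h (t (e.symm s)) (c (e.symm s)) := fun s => by
    rw [← hfe, e.apply_symm_apply]
  have key := (contDiff_and_tendstoSmooth (f := f) (v := fun n s => v n (e.symm s)) hq.smooth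
    (fun s => by rw [hfs]; exact H.contDiff_correction' hψ hq hh ht _)
    (fun n => e.symm.summable_iff.mpr (hv n)) (fun n s x => by rw [hfs]; exact hb n _ x)).2
  have e1 : (fun x => q x + ∑' s, f s x) = limitFun ψ q h t c := by
    funext x
    unfold limitFun
    rw [← e.tsum_eq fun s => f s x]
    simp only [hfe]
  have e2 : (fun (F : Finset (range t)) x => q x + ∑ s ∈ F, f s x) =
      qSub ψ q h (range t) τ := by
    funext F x
    unfold qSub
    rw [qFin_eq hψ.suppAnnulus hh.suppAnnulus]
    · simp [hf]
    · intro s hs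
      obtain ⟨⟨_, i, rfl⟩, _, rfl⟩ := Finset.mem_map.mp hs
      exact one_le_two.trans (H.two_le_scale ht i)
    · intro s hs s' hs' hne
      obtain ⟨⟨_, i, rfl⟩, _, rfl⟩ := Finset.mem_map.mp hs
      obtain ⟨⟨_, j, rfl⟩, _, rfl⟩ := Finset.mem_map.mp hs'
      exact H.scale_abs_sep ht fun hij => hne (by rw [hij])
  rw [e1, e2] at key
  exact key

end Cascade

end

theorem mainTheorem3 (ψ q h : ℝ → ℝ) (xInf : ℝ) (hψ : Cascade.IsCutoff ψ)
    (hq : Cascade.IsBase ψ q) (hh : Cascade.IsOscillating h xInf) :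
    ∃ (m : ℕ → ℕ) (t : ℕ → ℝ) (τ : ℝ → ℝ) (S : Set ℝ) (Q : ℝ → ℝ),
      (∀ i, 0 < m i) ∧
      S = Set.range t ∧ S.Infinite ∧ S ⊆ Set.Ici 1 ∧ (∀ i, t i + 1 ≤ t (i + 1)) ∧
      (∀ s ∈ S, τ s ≠ 0) ∧
      Q = Cascade.qSet ψ q h S τ ∧
      Cascade.TendstoSmooth (Cascade.qSub ψ q h S τ) Q atTop ∧
      ContDiff ℝ ∞ Q ∧ (∀ x, 0 < Q x) ∧
      ∀ i, ∃ Λ : ℝ, Cascade.IsFirstDirichletEigenvalue Q (m i) Λ ∧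
        Λ * Q ((4 : ℝ) ^ (-t i) * xInf) - (m i : ℝ) ^ 2 = 0 := by
  obtain ⟨M, hM⟩ := hh.exists_bound
  obtain ⟨a, b, c, m, H⟩ := Cascade.exists_admissibleSeq hψ hq hh M
  obtain ⟨t, ht, hΛ⟩ := H.exists_scales hψ hq hh hM
  have hsep : ∀ i, t i + 1 ≤ t (i + 1) := fun i => H.scale_sep ht (Nat.lt_succ_self i)
  have hinj : Function.Injective t :=
    (strictMono_nat_of_lt_succ fun i => by linarith [hsep i]).injective
  -- Distinct indices have distinct scales, so the amplitudes descend to a function of the scale;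
  -- its value off the range is immaterial.
  set τ : ℝ → ℝ := Function.extend t c 0 with hτdef
  have hτ : ∀ i, τ (t i) = c i := fun i => hinj.extend_apply c 0 i
  have hlim := H.tendstoSmooth_qSub hψ hq hh ht hτ
  have hpos := fun x => (H.limitFun_pos_le hψ hq hh hM ht x).1
  have hsmooth := H.contDiff_limitFun hψ hq hh ht
  refine ⟨m, t, τ, Set.range t, Cascade.limitFun ψ q h t c, fun i => (H.adm i).m_pos, rfl,
    Set.infinite_range_of_injective hinj, ?_, hsep, ?_, ?_, hlim, hsmooth, hpos, fun i => ?_⟩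
  · rintro _ ⟨i, rfl⟩
    exact one_le_two.trans (H.two_le_scale ht i)
  · rintro _ ⟨i, rfl⟩
    rw [hτ]
    exact (H.adm i).c_ne
  · funext x
    -- Convergence of the zeroth derivative identifies the pointwise limit that defines `qSet`.
    have h0 := (tendstoLocallyUniformlyOn_univ.mpr (hlim 0)).tendsto_at (Set.mem_univ x)
    simp only [iteratedDeriv_zero] at h0
    exact h0.limUnder_eq.symm
  · refine ⟨_, Cascade.isFirstDirichletEigenvalue_firstEigenvalue hsmooth.continuous
      fun x _ => hpos x, ?_⟩
    rw [H.limitFun_at_plateau hψ hh ht i]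
    exact hΛ i
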